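/- Equip $\mathbb{R}^d$ with the $\ell_1$ metric. There are absolute constants $A,B,K,k\in\mathbb{N}$ such that the following holds for all $n\ge 2$, $d\ge 2$, all sets $C=\{c_1,\dots,c_n\}$ of $n$ distinct points of $\mathbb{R}^d$, all $0<\epsilon<1/4$ and all $0<\delta<1$. Consider the following randomized data structure. *Preprocessing.* Put $T=\lceil A\log(n/\delta)/(\epsilon^3\delta^2)\rceil$, $m=\lceil B\log(n/\delta)/(\epsilon^2\delta^2)\rceil$ and, for $b\in[d]$, $p^{(b)}=\max_{i<j}|c_i^{(b)}-c_j^{(b)}|/\|c_i-c_j\|_1$. Starting from the empty multiset $I$, in each of $T$ rounds add every $b\in[d]$ to $I$ independently with probability $p^{(b)}$. Draw a matrix $M\in\mathbb{R}^{[m]\times I}$ with independent standard Cauchy entries (density $1/(\pi(1+x^2))$), independent of $I$. Let $r_i\in\mathbb{R}^I$ be the vector with $r_i^{(b)}=c_i^{(b)}/p^{(b)}$ for $b\in I$. Store $I$, $(p^{(b)})_{b\in I}$, $M$ and $Mr_1,\dots,Mr_n$. *Query.* Given $q\in\mathbb{R}^d$, read $q^{(b)}$ for $b\in I$, let $u^{(b)}=q^{(b)}/p^{(b)}$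 for $b\in I$, and return the (first) index $i$ for which the median of the absolute values of the entries of $Mr_i-Mu$ is smallest. The size in words counts one word per stored real number and $\lceil\log_2 d\rceil$ words per stored coordinate index. Then the data structure is constructed efficiently: written as a program for a real RAM that can compare numbers, take logarithms and draw uniform and Cauchy random numbers, the preprocessing always takes at most $K\,(nd/(\epsilon\delta))^k$ steps. Moreover, for every query point $q\in\mathbb{R}^d$, with probability at least $1-\delta$ over the random choices of the preprocessing, all of the following hold: (i) the query reads at most $K\,n\log(n/\delta)/(\epsilon^3\delta^2)$ coordinates of $q$ (counted with repetitions); (ii) it returns an index $i\in[n]$ such that $c_i$ is a $(1+\epsilon)$-approximate nearest neighbour of $q$, that is, $\|q-c_i\|_1\le(1+\epsilon)\min_{j\in[n]}\|q-c_j\|_1$; (iii) the data structure has size at most $K\,n\log^2(n/\delta)\log(d)/(\epsilon^5\delta^4)$ words. -/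

import Mathlib

open MeasureTheory

namespace L1NN

/-! ### Randomized real-RAM programs with a step count -/

/-- Unary instructions on real registers. -/
inductive UnOp
  | abs
  | log

/-- Binary instructions on real registers. -/
inductive BinOp
  | add
  | sub
  | mul
  | div
  | max

noncomputable def UnOp.eval : UnOp → ℝ → ℝ
  | .abs => fun x => |x|
  | .log => Real.log

noncomputable def BinOp.eval : BinOp → ℝ → ℝ → ℝ
  | .add => fun x y => x + y
  | .sub => fun x y => x - y
  | .mul => fun x y => x * y
  | .div => fun x y => x / y
  | .max => fun x y => Max.max x y

/-- A randomized real-RAM program with result in `α`. The type `V` of real registers is a parameter: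
a program that is polymorphic in `V` handles real numbers only through the instructions below,
and its control flow depends on them only through `less` and `ceil`.
* `nat k`: load the natural number `k` into a real register;
* `unary`, `binary`: one arithmetic instruction;
* `less x y`: branch on `x < y`;
* `ceil x`: the least natural number that is at least `x`, found by counting upwards from `0`;
* `uniform`, `cauchy`: draw a fresh independent random number, uniform in `[0,1]` or standard Cauchy. -/
inductive Prog (V α : Type) : Type
  | ret (a : α)
  | nat (k : ℕ) (next : V → Prog V α)
  | unary (f : UnOp) (x : V) (next : V → Prog V α)
  | binary (f : BinOp) (x y : V) (next : V → Prog V α)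
  | less (x y : V) (next : Bool → Prog V α)
  | ceil (x : V) (next : ℕ → Prog V α)
  | uniform (next : V → Prog V α)
  | cauchy (next : V → Prog V α)

namespace Prog

/-- Sequential composition. -/
def bind {V α β : Type} : Prog V α → (α → Prog V β) → Prog V β
  | ret a, g => g a
  | nat k next, g => nat k fun v => bind (next v) g
  | unary f x next, g => unary f x fun v => bind (next v) g
  | binary f x y next, g => binary f x y fun v => bind (next v) g
  | less x y next, g => less x y fun v => bind (next v) g
  | ceil x next, g => ceil x fun v => bind (next v) g
  | uniform next, g => uniform fun v => bind (next v) g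
  | cauchy next, g => cauchy fun v => bind (next v) g

instance {V : Type} : Monad (Prog V) where
  pure := ret
  bind := bind

end Prog

/-- The source of randomness: a sequence of numbers in `[0,1]` and a sequence of real numbers. -/
abbrev Tape : Type := (ℕ → unitInterval) × (ℕ → ℝ)

/-- The law of the source of randomness: all entries are independent, those of the first sequence
are uniform in `[0,1]`, those of the second have the Cauchy density `1 / (π (1 + x ^ 2))`. -/
noncomputable def tapeLaw : Measure Tape :=
  (Measure.infinitePi fun _ : ℕ => (volume : Measure unitInterval)).prod
    (Measure.infinitePi fun _ : ℕ => ProbabilityTheory.cauchyMeasure 0 1)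

/-- Counters of a run: how many uniform and how many Cauchy numbers have been drawn so far, and how
many steps have been made. -/
structure Counters where
  uniforms : ℕ
  cauchys : ℕ
  steps : ℕ

/-- `t` further steps. -/
def Counters.tick (s : Counters) (t : ℕ) : Counters := { s with steps := s.steps + t }

/-- Execution of a program: its result and the final counters. Every instruction costs one step,
except that `ceil` costs one step for each number it passes in counting. -/
noncomputable def Prog.run {α : Type} (ω : Tape) : Prog ℝ α → Counters → α × Counters
  | .ret a, s => (a, s)
  | .nat k next, s => run ω (next k) (s.tick 1)
  | .unary f x next, s => run ω (next (f.eval x)) (s.tick 1)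
  | .binary f x y next, s => run ω (next (f.eval x y)) (s.tick 1)
  | .less x y next, s => run ω (next (decide (x < y))) (s.tick 1)
  | .ceil x next, s => run ω (next ⌈x⌉₊) (s.tick (⌈x⌉₊ + 1))
  | .uniform next, s =>
      run ω (next (ω.1 s.uniforms : ℝ)) { s.tick 1 with uniforms := s.uniforms + 1 }
  | .cauchy next, s =>
      run ω (next (ω.2 s.cauchys)) { s.tick 1 with cauchys := s.cauchys + 1 }

/-! ### Basic programs -/

section Programs

variable {V : Type}

def natConst (k : ℕ) : Prog V V := .nat k .ret
def logOp (x : V) : Prog V V := .unary .log x .ret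
def absOp (x : V) : Prog V V := .unary .abs x .ret
def addOp (x y : V) : Prog V V := .binary .add x y .ret
def subOp (x y : V) : Prog V V := .binary .sub x y .ret
def mulOp (x y : V) : Prog V V := .binary .mul x y .ret
def divOp (x y : V) : Prog V V := .binary .div x y .ret
def maxOp (x y : V) : Prog V V := .binary .max x y .ret
def lessOp (x y : V) : Prog V Bool := .less x y .ret
def ceilOp (x : V) : Prog V ℕ := .ceil x .ret
def drawUniform : Prog V V := .uniform .ret
def drawCauchy : Prog V V := .cauchy .ret

/-- Run `f` on all entries of a list, from left to right, and collect the results. -/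
def forEach {α β : Type} (f : α → Prog V β) : List α → Prog V (List β)
  | [] => pure []
  | a :: l => do
      let b ← f a
      let bs ← forEach f l
      pure (b :: bs)

/-- Run the test `f` on all entries of a list, from left to right, and keep those that pass. -/
def select {α : Type} (f : α → Prog V Bool) : List α → Prog V (List α)
  | [] => pure []
  | a :: l => do
      let keep ← f a
      let as ← select f l
      pure (if keep then a :: as else as)

/-- The sum of a list of numbers. -/
def sumList : List V → Prog V V
  | [] => natConst 0
  | x :: l => do
      let s ← sumList l
      addOp x s

/-- The maximum of `0` and of the entries of a list. -/
def maxList : List V → Prog V V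
  | [] => natConst 0
  | x :: l => do
      let s ← maxList l
      maxOp x s

/-- `|x - y|`. -/
def absDiff (x y : V) : Prog V V := do
  let z ← subOp x y
  absOp z

/-- The `ℓ₁` distance of two points. -/
def l1Dist {d : ℕ} (x y : Fin d → V) : Prog V V := do
  let l ← forEach (fun b => absDiff (x b) (y b)) (List.finRange d)
  sumList l

/-- The inner product of two lists. -/
def dotProd (x y : List V) : Prog V V := do
  let l ← forEach (fun z : V × V => mulOp z.1 z.2) (x.zip y)
  sumList l

/-! ### The data structure -/

/-- The sampling probability of coordinate `b`: the maximum of `|cᵢ⁽ᵇ⁾ - cⱼ⁽ᵇ⁾| / ‖cᵢ - cⱼ‖₁` over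
all pairs `i < j`. -/
def samplingProb {n d : ℕ} (c : Fin n → Fin d → V) (b : Fin d) : Prog V V := do
  let l ← forEach
    (fun ij : Fin n × Fin n => do
      let num ← absDiff (c ij.1 b) (c ij.2 b)
      let den ← l1Dist (c ij.1) (c ij.2)
      divOp num den)
    ((List.finRange n ×ˢ List.finRange n).filter fun ij => ij.1 < ij.2)
  maxList l

/-- `⌈C * log (n / δ) / (ε ^ r * δ ^ 2)⌉`. -/
def parameter (C n r : ℕ) (ε δ : V) : Prog V ℕ := do
  let cV ← natConst C
  let nV ← natConst n
  let x ← divOp nV δ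
  let y ← logOp x
  let z ← mulOp cV y
  let one ← natConst 1
  let e ← (List.replicate r ε).foldlM mulOp one
  let e₁ ← mulOp e δ
  let e₂ ← mulOp e₁ δ
  let w ← divOp z e₂
  ceilOp w

/-- What is kept in memory for `n` points in dimension `d`: the multiset `I` of sampled coordinates
(listed with repetitions), the sampling probabilities of its members, the rows of the sketching
matrix `M`, whose columns are indexed by `I`, and the sketches `M rᵢ` of the `n` points. -/
structure Memory (V : Type) (n d : ℕ) where
  coords : List (Fin d)
  probs : List V
  matrix : List (List V)
  sketch : Fin n → List V

/-- The size in words: one word for each stored real number and `⌈log₂ d⌉` words for each stored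
coordinate index. -/
def Memory.words {n d : ℕ} (D : Memory V n d) : ℕ :=
  D.coords.length * Nat.clog 2 d + D.probs.length + (D.matrix.map List.length).sum +
    ∑ i, (D.sketch i).length

/-- Preprocessing. The natural numbers `A` and `B` are the constants in the number of rounds
`T = ⌈A log (n/δ) / (ε³ δ²)⌉` and in the sketch length `m = ⌈B log (n/δ) / (ε² δ²)⌉`.
In each of `T` rounds every coordinate `b` is added to `I` with probability `p⁽ᵇ⁾`, independently.
Then an `m × I` matrix `M` of independent Cauchy variables is drawn, and the vectors `M rᵢ` are
computed, where `rᵢ⁽ᵇ⁾ = cᵢ⁽ᵇ⁾ / p⁽ᵇ⁾` for `b ∈ I`. -/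
def preprocess {n d : ℕ} (A B : ℕ) (c : Fin n → Fin d → V) (ε δ : V) :
    Prog V (Memory V n d) := do
  let T ← parameter A n 3 ε δ
  let m ← parameter B n 2 ε δ
  let ps ← forEach (fun b => do
      let p ← samplingProb c b
      pure (b, p)) (List.finRange d)
  let rounds ← forEach (fun _ => select (fun bp : Fin d × V => do
      let u ← drawUniform
      lessOp u bp.2) ps) (List.range T)
  let I := rounds.flatten
  let M ← forEach (fun _ => forEach (fun _ => drawCauchy) I) (List.range m)
  let sketches ← forEach (fun i => do
      let r ← forEach (fun bp : Fin d × V => divOp (c i bp.1) bp.2) I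
      forEach (fun row => dotProd row r) M) (List.finRange n)
  pure {
    coords := I.map Prod.fst
    probs := I.map Prod.snd
    matrix := M
    sketch := fun i => sketches.getD i [] }

end Programs

/-- The median of a list of real numbers (the mean of the two middle entries if their number is
even). -/
noncomputable def median (l : List ℝ) : ℝ :=
  let s := l.insertionSort (· ≤ ·)
  (s.getD ((s.length - 1) / 2) 0 + s.getD (s.length / 2) 0) / 2

/-- Answering a query from the memory `D` and the list `vals` of the values of the query point at
the coordinates in `D.coords`: with `u⁽ᵇ⁾ = q⁽ᵇ⁾ / p⁽ᵇ⁾` for `b ∈ I`, return the index `i` for which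
the median of the absolute values of the entries of `M rᵢ - M u` is smallest. -/
noncomputable def answer {n d : ℕ} (D : Memory ℝ n d) (vals : List ℝ) : Option (Fin n) :=
  let u := List.zipWith (· / ·) vals D.probs
  let v := D.matrix.map fun row => (List.zipWith (· * ·) row u).sum
  (List.finRange n).argmin fun i => median (List.zipWith (fun x y => |x - y|) (D.sketch i) v)

/-- The query procedure reads the coordinates of `q` listed in `D.coords`, and no others. -/
noncomputable def query {n d : ℕ} (D : Memory ℝ n d) (q : Fin d → ℝ) : Option (Fin n) :=
  answer D (D.coords.map q)

/-- The number of coordinates of the query point that are read, counted with repetitions. -/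
def Memory.reads {V : Type} {n d : ℕ} (D : Memory V n d) : ℕ := D.coords.length

/-- The space `ℝ^d` with the `ℓ₁` metric. -/
abbrev L1Space (d : ℕ) : Type := PiLp 1 fun _ : Fin d => ℝ

/-- The run of the preprocessing on the points `c` with the source of randomness `ω`. -/
noncomputable def execute {n d : ℕ} (A B : ℕ) (c : Fin n → L1Space d) (ε δ : ℝ) (ω : Tape) :
    Memory ℝ n d × Counters :=
  (preprocess A B (fun i b => c i b) ε δ).run ω ⟨0, 0, 0⟩

/-- The data structure that is built. -/
noncomputable def build {n d : ℕ} (A B : ℕ) (c : Fin n → L1Space d) (ε δ : ℝ) (ω : Tape) :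
    Memory ℝ n d :=
  (execute A B c ε δ ω).1

/-- The number of steps of the preprocessing. -/
noncomputable def buildSteps {n d : ℕ} (A B : ℕ) (c : Fin n → L1Space d) (ε δ : ℝ) (ω : Tape) : ℕ :=
  (execute A B c ε δ ω).2.steps

/-- `c i` is an `α`-approximate nearest neighbour of `q` among the points `c`. -/
def IsApproxNearest {X : Type*} [PseudoMetricSpace X] {n : ℕ} (α : ℝ) (c : Fin n → X) (q : X)
    (i : Fin n) : Prop :=
  dist q (c i) ≤ α * ⨅ j, dist q (c j)

end L1NN

namespace L1NN

open ProbabilityTheory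
open scoped FourierTransform NNReal

/-! ### The Cauchy distribution -/

/-! Write `N_i = ‖c_i - q‖₁` and let `R_i` be the `ℓ₁` distance of `r_i` and `u`, that is, the sum
of `|c_i - q| / p` over the sampled coordinates.

Size. The sampling probabilities add up to at most `n` (`sum_coordProb_le`). Among the normalized
differences of the points take a tuple of maximal determinant, spanning the same space. By Cramer's
rule every normalized difference is a combination of this tuple with coefficients in `[-1, 1]`, so
`p⁽ᵇ⁾` is at most the sum of the `b`-th absolute entries of at most `n` vectors of norm at most one.
A Chernoff bound then gives `|I| ≤ 3Tn` with high probability.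

Correctness. A single `R_i` need not concentrate, because `q` may be far from all points in a
coordinate of tiny probability. The difference `R_i - R_j` does: its terms are bounded by `|c_i -
c_j| / p ≤ ‖c_i - c_j‖₁`, and its mean is exactly `T (N_i - N_j)`. If `c_j` is nearest and `N_i > (1
+ ε) N_j`, then `N_i - N_j ≥ ε ‖c_i - c_j‖₁ / 3`, and Chernoff yields `R_i - R_j > T (N_i - N_j) /
2` (`measure_sampledDist_lt`). The size of `R_j` is controlled only by Markov: `R_j ≤ 4 T N_j / δ`
outside an event of probability `δ / 4`. Hence the sketch must have relative accuracy of order `ε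
δ`, whence the factor `1 / (ε² δ²)` in its length (`Good.approx`).

Sketch. The Cauchy law is 1-stable (`map_sum_cauchy`), so each row of `M (r_i - u)` is distributed
as `R_i` times a Cauchy variable, whose absolute value has median one and positive density there.
Hoeffding turns this into concentration of the empirical median (`measure_sketch_le`).

The program is evaluated once and for all as an explicit function of the tape (`preprocess_eval`),
which gives the worst-case step count and reduces the rest to probability. Given the finitely many
possible samples, the two sources of randomness are combined by `measure_prod_le_of_finite`. -/

lemma integrable_exp_neg_abs_smul (w : ℂ) (hw : w.re = 0) :
    Integrable fun x : ℝ => Complex.exp (w * x) * ((Real.exp (-|x|) : ℝ) : ℂ) := by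
  rw [← integrableOn_univ, ← Set.Iic_union_Ioi (a := (0 : ℝ)), integrableOn_union]
  constructor
  · refine (integrableOn_exp_mul_complex_Iic (a := w + 1) (by simp [hw]) 0).congr_fun ?_
      measurableSet_Iic
    intro x hx
    simp only [abs_of_nonpos (Set.mem_Iic.1 hx), Complex.ofReal_exp, ← Complex.exp_add]
    congr 1; push_cast; ring
  · refine (integrableOn_exp_mul_complex_Ioi (a := w - 1) (by simp [hw]) 0).congr_fun ?_
      measurableSet_Ioi
    intro x hx
    simp only [abs_of_pos (Set.mem_Ioi.1 hx), Complex.ofReal_exp, ← Complex.exp_add]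
    congr 1; push_cast; ring

lemma integral_exp_neg_abs_smul (w : ℂ) (hw : w.re = 0) :
    ∫ x : ℝ, Complex.exp (w * x) * ((Real.exp (-|x|) : ℝ) : ℂ) = 2 / (1 - w ^ 2) := by
  rw [← intervalIntegral.integral_Iic_add_Ioi (b := (0 : ℝ))
    (integrable_exp_neg_abs_smul w hw).integrableOn (integrable_exp_neg_abs_smul w hw).integrableOn]
  have h1 : ∫ x : ℝ in Set.Iic 0, Complex.exp (w * x) * ((Real.exp (-|x|) : ℝ) : ℂ)
      = ∫ x : ℝ in Set.Iic 0, Complex.exp ((w + 1) * x) := by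
    refine setIntegral_congr_fun measurableSet_Iic ?_
    intro x hx
    simp only [abs_of_nonpos (Set.mem_Iic.1 hx), Complex.ofReal_exp, ← Complex.exp_add]
    congr 1; push_cast; ring
  have h2 : ∫ x : ℝ in Set.Ioi 0, Complex.exp (w * x) * ((Real.exp (-|x|) : ℝ) : ℂ)
      = ∫ x : ℝ in Set.Ioi 0, Complex.exp ((w - 1) * x) := by
    refine setIntegral_congr_fun measurableSet_Ioi ?_
    intro x hx
    simp only [abs_of_pos (Set.mem_Ioi.1 hx), Complex.ofReal_exp, ← Complex.exp_add]
    congr 1; push_cast; ring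
  rw [h1, h2, integral_exp_mul_complex_Iic (by simp [hw]), integral_exp_mul_complex_Ioi (by simp [hw])]
  have a1 : w + 1 ≠ 0 := fun h => by simpa [hw] using congrArg Complex.re h
  have a2 : w - 1 ≠ 0 := fun h => by simpa [hw] using congrArg Complex.re h
  have a3 : 1 - w ^ 2 ≠ 0 := by
    rw [show 1 - w ^ 2 = -((w + 1) * (w - 1)) by ring]
    exact neg_ne_zero.2 (mul_ne_zero a1 a2)
  simp only [Complex.ofReal_zero, mul_zero, Complex.exp_zero]
  field_simp
  ring

lemma fourier_exp_neg_abs :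
    𝓕 (fun x : ℝ => ((Real.exp (-|x|) : ℝ) : ℂ)) =
      fun ξ : ℝ => ((2 * (1 + (2 * Real.pi * ξ) ^ 2)⁻¹ : ℝ) : ℂ) := by
  ext ξ
  rw [Real.fourier_real_eq_integral_exp_smul]
  have h := integral_exp_neg_abs_smul (((-2 * Real.pi * ξ : ℝ) : ℂ) * Complex.I) (by simp)
  have e : ∀ v : ℝ, Complex.exp (((-2 * Real.pi * v * ξ : ℝ) : ℂ) * Complex.I) •
      ((Real.exp (-|v|) : ℝ) : ℂ) =
      Complex.exp ((((-2 * Real.pi * ξ : ℝ) : ℂ) * Complex.I) * v) * ((Real.exp (-|v|) : ℝ) : ℂ) := by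
    intro v
    rw [smul_eq_mul]
    congr 2
    push_cast; ring
  simp_rw [e, h]
  rw [mul_pow, Complex.I_sq]
  push_cast
  rw [div_eq_mul_inv]
  congr 2
  ring

/-- The characteristic function of the standard Cauchy distribution. -/
lemma charFun_cauchyMeasure (t : ℝ) :
    charFun (cauchyMeasure 0 1) t = ((Real.exp (-|t|) : ℝ) : ℂ) := by
  have hint : Integrable fun x : ℝ => ((Real.exp (-|x|) : ℝ) : ℂ) := by
    simpa using integrable_exp_neg_abs_smul 0 (by simp)
  have hF : Integrable (𝓕 (fun x : ℝ => ((Real.exp (-|x|) : ℝ) : ℂ))) := by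
    rw [fourier_exp_neg_abs]
    exact ((integrable_inv_one_add_sq.comp_mul_left' (R := 2 * Real.pi)
      (by positivity)).const_mul 2).ofReal
  -- Fourier inversion at `t`: up to the substitution `y = 2πx`, the inverse transform of `2 / (1 +
  -- (2πξ)²)` is the integral defining the characteristic function.
  have hinv := congrFun ((by fun_prop : Continuous fun x : ℝ =>
    ((Real.exp (-|x|) : ℝ) : ℂ)).fourierInv_fourier_eq hint hF) t
  rw [← hinv, Real.fourierInv_eq', fourier_exp_neg_abs, charFun_apply_real,
    cauchyMeasure_of_scale_ne_zero _ one_ne_zero,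
    integral_withDensity_eq_integral_toReal_smul (by fun_prop)
      (by filter_upwards with x using by simp [cauchyPDF])]
  have hsub := Measure.integral_comp_mul_left (fun y : ℝ =>
    (cauchyPDF 0 1 y).toReal • Complex.exp ((t : ℂ) * y * Complex.I)) (2 * Real.pi)
  have hpi : (0 : ℝ) < 2 * Real.pi := by positivity
  rw [abs_of_pos (inv_pos.2 hpi), eq_comm, inv_smul_eq_iff₀ hpi.ne'] at hsub
  rw [hsub, ← integral_smul]
  refine integral_congr_ae (Filter.Eventually.of_forall fun x => ?_)
  have h1 : (cauchyPDF 0 1 (2 * Real.pi * x)).toReal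
      = Real.pi⁻¹ * (1 + (2 * Real.pi * x) ^ 2)⁻¹ := by
    rw [cauchyPDF, ENNReal.toReal_ofReal (cauchyPDF_pos 0 one_ne_zero _).le, cauchyPDFReal_def']
    simp
  simp only [h1, Complex.real_smul, smul_eq_mul, RCLike.inner_apply, conj_trivial]
  rw [show (t : ℂ) * ((2 * Real.pi * x : ℝ) : ℂ) * Complex.I
    = ((2 * Real.pi * (t * x) : ℝ) : ℂ) * Complex.I by push_cast; ring]
  have : (Real.pi : ℂ) ≠ 0 := by exact_mod_cast Real.pi_ne_zero
  push_cast
  field_simp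

/-- A linear combination of independent Cauchy variables is a scaled Cauchy variable. -/
lemma map_sum_cauchy {J ι : Type*} [Fintype J] {f : J → ι} (hf : Function.Injective f) (w : J → ℝ) :
    (Measure.infinitePi fun _ : ι => cauchyMeasure 0 1).map (fun y => ∑ j, w j * y (f j)) =
      (cauchyMeasure 0 1).map fun x => (∑ j, |w j|) * x := by
  have hind : iIndepFun (fun (j : J) (y : ι → ℝ) => w j * y (f j))
      (Measure.infinitePi fun _ : ι => cauchyMeasure 0 1) := by
    have h := (iIndepFun_infinitePi (P := fun _ : ι => cauchyMeasure 0 1) (X := fun _ x => x)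
      (fun _ => measurable_id)).precomp hf
    exact h.comp (fun j x => w j * x) (fun j => by fun_prop)
  have : IsProbabilityMeasure ((Measure.infinitePi fun _ : ι => cauchyMeasure 0 1).map
    (fun y => ∑ j, w j * y (f j))) :=
    Measure.isProbabilityMeasure_map (Measurable.aemeasurable (by fun_prop))
  have : IsProbabilityMeasure ((cauchyMeasure 0 1).map fun x => (∑ j, |w j|) * x) :=
    Measure.isProbabilityMeasure_map (by fun_prop)
  -- By independence the characteristic function of the sum is the product of the `exp (-|w j *
  -- t|)`, which is that of a Cauchy variable scaled by `∑ |w j|`.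
  apply Measure.ext_of_charFun
  ext t
  rw [hind.charFun_map_fun_sum_eq_prod (fun j => Measurable.aemeasurable (by fun_prop)), Finset.prod_apply,
    charFun_map_mul, charFun_cauchyMeasure]
  have h1 : ∀ j, charFun ((Measure.infinitePi fun _ : ι => cauchyMeasure 0 1).map
      (fun y => w j * y (f j))) t = ((Real.exp (-|w j * t|) : ℝ) : ℂ) := by
    intro j
    rw [← charFun_cauchyMeasure, ← charFun_map_mul]
    nth_rewrite 2 [← Measure.infinitePi_map_eval (fun _ : ι => cauchyMeasure 0 1) (f j)]
    rw [Measure.map_map (by fun_prop) (by fun_prop)]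
    rfl
  simp_rw [h1]
  rw [← Complex.ofReal_prod, ← Real.exp_sum, abs_mul,
    abs_of_nonneg (Finset.sum_nonneg fun j _ => abs_nonneg (w j)), Finset.sum_mul]
  simp [abs_mul]

lemma cauchyMeasure_Icc {a : ℝ} (ha : 0 ≤ a) :
    (cauchyMeasure 0 1).real (Set.Icc (-a) a) = 2 / Real.pi * Real.arctan a := by
  rw [cauchyMeasure_of_scale_ne_zero _ one_ne_zero, Measure.real,
    withDensity_apply _ measurableSet_Icc]
  unfold cauchyPDF
  rw [← integral_eq_lintegral_of_nonneg_ae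
    (ae_of_all _ fun x => (cauchyPDF_pos 0 one_ne_zero x).le) (by fun_prop),
    integral_Icc_eq_integral_Ioc, ← intervalIntegral.integral_of_le (by linarith)]
  simp only [cauchyPDFReal_def', NNReal.coe_one, inv_one, mul_one, sub_zero, div_one]
  rw [intervalIntegral.integral_const_mul, integral_inv_one_add_sq, Real.arctan_neg]
  ring

/-- The derivative `1 / (1 + x²)` is at least `1 / 5` on `[-2, 2]`. This makes the distribution
function of `|x|` grow at a definite rate around its median `1`, where `arctan 1 = π / 4`. -/
lemma arctan_sub_monotoneOn :
    MonotoneOn (fun x : ℝ => Real.arctan x - x / 5) (Set.Icc (-2) 2) := by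
  refine monotoneOn_of_deriv_nonneg (convex_Icc _ _) (by fun_prop)
    (Real.differentiable_arctan.sub (by fun_prop)).differentiableOn ?_
  intro x hx
  rw [interior_Icc] at hx
  have h : HasDerivAt (fun x : ℝ => Real.arctan x - x / 5) (1 / (1 + x ^ 2) - 1 / 5) x :=
    (Real.hasDerivAt_arctan x).sub ((hasDerivAt_id x).div_const 5)
  rw [h.deriv, sub_nonneg]
  apply one_div_le_one_div_of_le <;> nlinarith [hx.1, hx.2]

lemma two_div_pi_mul_div_five {η : ℝ} (h0 : 0 ≤ η) : η / 10 ≤ 2 / Real.pi * (η / 5) := by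
  have : (1 : ℝ) / 2 ≤ 2 / Real.pi := by
    rw [div_le_div_iff₀ two_pos Real.pi_pos]; linarith [Real.pi_le_four]
  nlinarith

lemma cauchyMeasure_abs_lt {η : ℝ} (h0 : 0 ≤ η) (h1 : η ≤ 1) :
    (cauchyMeasure 0 1).real {x | |x| < 1 - η} ≤ 1 / 2 - η / 10 := by
  have hm : Real.arctan (1 - η) - (1 - η) / 5 ≤ Real.arctan 1 - 1 / 5 :=
    arctan_sub_monotoneOn ⟨by linarith, by linarith⟩ ⟨by norm_num, by norm_num⟩ (by linarith)
  rw [Real.arctan_one] at hm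
  calc (cauchyMeasure 0 1).real {x | |x| < 1 - η}
      ≤ (cauchyMeasure 0 1).real (Set.Icc (-(1 - η)) (1 - η)) :=
        measureReal_mono fun x hx => abs_le.1 (le_of_lt hx)
    _ = 2 / Real.pi * Real.arctan (1 - η) := cauchyMeasure_Icc (by linarith)
    _ ≤ 2 / Real.pi * (Real.pi / 4 - η / 5) := by gcongr; linarith
    _ = 1 / 2 - 2 / Real.pi * (η / 5) := by field_simp; ring
    _ ≤ 1 / 2 - η / 10 := by linarith [two_div_pi_mul_div_five h0]

lemma cauchyMeasure_lt_abs {η : ℝ} (h0 : 0 ≤ η) (h1 : η ≤ 1) :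
    (cauchyMeasure 0 1).real {x | 1 + η < |x|} ≤ 1 / 2 - η / 10 := by
  have hm : Real.arctan 1 - 1 / 5 ≤ Real.arctan (1 + η) - (1 + η) / 5 :=
    arctan_sub_monotoneOn ⟨by norm_num, by norm_num⟩ ⟨by linarith, by linarith⟩ (by linarith)
  rw [Real.arctan_one] at hm
  have hc : {x : ℝ | 1 + η < |x|} = (Set.Icc (-(1 + η)) (1 + η))ᶜ := by
    ext x
    rw [Set.mem_compl_iff, Set.mem_Icc, ← abs_le, not_le]
    rfl
  calc (cauchyMeasure 0 1).real {x | 1 + η < |x|}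
      = 1 - 2 / Real.pi * Real.arctan (1 + η) := by
        rw [hc, probReal_compl_eq_one_sub measurableSet_Icc, cauchyMeasure_Icc (by linarith)]
    _ ≤ 1 - 2 / Real.pi * (Real.pi / 4 + η / 5) := by gcongr; linarith
    _ = 1 / 2 - 2 / Real.pi * (η / 5) := by field_simp; ring
    _ ≤ 1 / 2 - η / 10 := by linarith [two_div_pi_mul_div_five h0]

/-! ### Tail bounds -/

/-- If an event has probability at most `1 / 2 - γ`, then it is unlikely to happen in at least half
of `m` independent trials. -/
lemma measure_half_trials_le {E : Type*} [MeasurableSpace E] (ν : Measure E)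
    [IsProbabilityMeasure ν] {S : Set E} (hS : MeasurableSet S) {γ : ℝ} (hγ : 0 ≤ γ)
    (h : ν.real S ≤ 1 / 2 - γ) (m : ℕ) :
    (Measure.infinitePi fun _ : ℕ => ν).real
      {y | (m : ℝ) ≤ 2 * ∑ k ∈ Finset.range m, S.indicator (fun _ => (1 : ℝ)) (y k)} ≤
      Real.exp (-(2 * γ ^ 2 * m)) := by
  set μ := Measure.infinitePi fun _ : ℕ => ν with hμ
  set Y : ℕ → (ℕ → E) → ℝ := fun k y => S.indicator (fun _ => (1 : ℝ)) (y k) with hY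
  have hm0 : Measurable (S.indicator fun _ => (1 : ℝ)) := measurable_const.indicator hS
  have hm : ∀ k, Measurable (Y k) := fun k => hm0.comp (measurable_pi_apply k)
  have hmean : ∀ k, μ[Y k] = ν.real S := by
    intro k
    have : ν = μ.map (fun y => y k) := (Measure.infinitePi_map_eval (fun _ : ℕ => ν) k).symm
    calc μ[Y k] = ∫ e, S.indicator (fun _ => (1 : ℝ)) e ∂(μ.map (fun y => y k)) := by
          rw [integral_map (measurable_pi_apply k).aemeasurable hm0.aestronglyMeasurable]
      _ = ν.real S := by rw [← this, integral_indicator_const _ hS]; simp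
  have hindY : iIndepFun Y μ := iIndepFun_infinitePi (P := fun _ : ℕ => ν)
    (X := fun _ => S.indicator fun _ => (1 : ℝ)) (fun _ => hm0)
  have hind : iIndepFun (fun k y => Y k y - μ[Y k]) μ :=
    hindY.comp (g := fun k x => x - ∫ z, Y k z ∂μ) (fun k => by fun_prop)
  -- A variable with values in `[0, 1]` is sub-Gaussian with parameter `1 / 4` after centering. A
  -- deviation `γ m` of the sum thus has probability at most `exp (-(γ m)² / (2 m / 4))`.
  have hsub : ∀ k < m, HasSubgaussianMGF (fun y => Y k y - μ[Y k]) ((‖(1 : ℝ) - 0‖₊ / 2) ^ 2) μ := by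
    intro k _
    refine hasSubgaussianMGF_of_mem_Icc (hm k).aemeasurable (ae_of_all _ fun y => ?_)
    by_cases hy : y k ∈ S <;> simp [hY, hy]
  refine (measureReal_mono ?_).trans
    ((HasSubgaussianMGF.measure_sum_range_ge_le_of_iIndepFun hind hsub
      (ε := γ * m) (by positivity)).trans ?_)
  · intro y hy
    simp only [Set.mem_ofPred_eq, hmean, Finset.sum_sub_distrib, Finset.sum_const,
      Finset.card_range, nsmul_eq_mul] at hy ⊢
    have : (m : ℝ) * ν.real S ≤ m * (1 / 2 - γ) := by gcongr
    linarith
  · rw [Real.exp_le_exp]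
    simp only [sub_zero, nnnorm_one, NNReal.coe_pow, NNReal.coe_div, NNReal.coe_one,
      NNReal.coe_ofNat]
    rcases Nat.eq_zero_or_pos m with rfl | hm
    · simp
    have : (0 : ℝ) < m := by exact_mod_cast hm
    apply le_of_eq
    field_simp

/-- The sum of the `a j` over those `j` that are selected by the uniform variables. -/
noncomputable def selectedSum {J : Type*} [Fintype J] (f : J → ℕ) (p a : J → ℝ)
    (x : ℕ → unitInterval) : ℝ :=
  ∑ j, {u : unitInterval | (u : ℝ) < p j}.indicator (fun _ => a j) (x (f j))

section selectedSum

variable {J : Type*} [Fintype J] {f : J → ℕ} {p a : J → ℝ}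

lemma measurableSet_lt_coe (r : ℝ) : MeasurableSet {u : unitInterval | (u : ℝ) < r} :=
  measurableSet_lt measurable_subtype_coe measurable_const

lemma measurable_indicator_lt_coe (r s : ℝ) :
    Measurable ({u : unitInterval | (u : ℝ) < r}.indicator fun _ => s) :=
  measurable_const.indicator (measurableSet_lt_coe r)

lemma volume_lt_coe {r : ℝ} (h0 : 0 ≤ r) (h1 : r ≤ 1) :
    (volume : Measure unitInterval).real {u | (u : ℝ) < r} = r := by
  have : {u : unitInterval | (u : ℝ) < r} = Set.Iio ⟨r, h0, h1⟩ := by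
    ext u; simp [← Subtype.coe_lt_coe]
  rw [this, Measure.real, unitInterval.volume_Iio, ENNReal.toReal_ofReal h0]

/-- A Chernoff bound for the lower tail of a sum of independent scaled Bernoulli variables. -/
lemma measure_selectedSum_le (hf : Function.Injective f) (hp0 : ∀ j, 0 ≤ p j) (hp1 : ∀ j, p j ≤ 1)
    {l : ℝ} (hl : 0 ≤ l) (hla : ∀ j, |l * a j| ≤ 1) (s : ℝ) :
    (Measure.infinitePi fun _ : ℕ => (volume : Measure unitInterval)).real
      {x | selectedSum f p a x ≤ s} ≤
      Real.exp (l * s - l * ∑ j, p j * a j + l ^ 2 * ∑ j, p j * a j ^ 2) := by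
  set μ := Measure.infinitePi fun _ : ℕ => (volume : Measure unitInterval) with hμ
  set Y : J → (ℕ → unitInterval) → ℝ :=
    fun j x => {u : unitInterval | (u : ℝ) < p j}.indicator (fun _ => a j) (x (f j)) with hY
  have hm : ∀ j, Measurable (Y j) := fun j =>
    (measurable_indicator_lt_coe _ _).comp (measurable_pi_apply _)
  have hind : iIndepFun Y μ :=
    ((iIndepFun_infinitePi (P := fun _ : ℕ => (volume : Measure unitInterval)) (X := fun _ u => u)
      (fun _ => measurable_id)).precomp hf).comp
        (fun j => {u : unitInterval | (u : ℝ) < p j}.indicator fun _ => a j)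
        (fun j => measurable_indicator_lt_coe _ _)
  have hmgf : ∀ j, mgf (Y j) μ (-l) ≤ Real.exp (-l * (p j * a j) + l ^ 2 * (p j * a j ^ 2)) := by
    intro j
    set S : Set unitInterval := {u : unitInterval | (u : ℝ) < p j} with hS
    have hSm : MeasurableSet S := measurableSet_lt_coe _
    have h1 : ∀ x, Real.exp (-l * Y j x) =
        1 + S.indicator (fun _ => Real.exp (-l * a j) - 1) (x (f j)) := by
      intro x
      by_cases hx : x (f j) ∈ S <;> simp [hY, ← hS, hx]
    have hev : (volume : Measure unitInterval) = μ.map (fun y => y (f j)) :=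
      (Measure.infinitePi_map_eval (fun _ : ℕ => (volume : Measure unitInterval)) (f j)).symm
    have h2 : ∫ x, S.indicator (fun _ => Real.exp (-l * a j) - 1) (x (f j)) ∂μ
        = p j * (Real.exp (-l * a j) - 1) := by
      rw [← integral_map (φ := fun x : ℕ → unitInterval => x (f j))
        (measurable_pi_apply _).aemeasurable
        (measurable_indicator_lt_coe _ _).aestronglyMeasurable, ← hev,
        integral_indicator_const _ hSm, volume_lt_coe (hp0 j) (hp1 j), smul_eq_mul]
    have hint : Integrable (fun x => S.indicator (fun _ => Real.exp (-l * a j) - 1) (x (f j))) μ := by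
      refine Integrable.of_bound ((measurable_indicator_lt_coe (p j) _).comp
        (measurable_pi_apply (f j))).aestronglyMeasurable (|Real.exp (-l * a j) - 1|)
        (ae_of_all _ fun x => ?_)
      by_cases hx : x (f j) ∈ S <;> simp [hx]
    have h3 : mgf (Y j) μ (-l) = 1 + p j * (Real.exp (-l * a j) - 1) := by
      rw [mgf]
      simp_rw [h1]
      rw [integral_add (integrable_const _) hint, h2]
      simp
    rw [h3]
    -- For `|x| ≤ 1` one has `exp x ≤ 1 + x + x²`; together with `1 + y ≤ exp y` this bounds the
    -- moment generating function of a scaled Bernoulli variable.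
    have h4 := (abs_le.1 (Real.abs_exp_sub_one_sub_id_le (x := -l * a j)
      (by rw [neg_mul, abs_neg]; exact hla j))).2
    have h5 : p j * (Real.exp (-l * a j) - 1) ≤ p j * (-l * a j + (-l * a j) ^ 2) :=
      mul_le_mul_of_nonneg_left (by linarith) (hp0 j)
    have h6 := Real.add_one_le_exp (-l * (p j * a j) + l ^ 2 * (p j * a j ^ 2))
    nlinarith
  have hYint : Integrable (fun x => Real.exp (-l * (∑ j, Y j) x)) μ := by
    refine hind.integrable_exp_mul_sum hm fun j _ => ?_
    refine Integrable.of_bound (by fun_prop) (Real.exp 1)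
      (ae_of_all _ fun x => ?_)
    rw [Real.norm_eq_abs, Real.abs_exp, Real.exp_le_exp]
    by_cases hx : x (f j) ∈ {u : unitInterval | (u : ℝ) < p j}
    · simp only [hY, Set.indicator_of_mem hx]
      linarith [(abs_le.1 (hla j)).1]
    · simp [hY, Set.indicator_of_notMem hx]
  have key := measure_le_le_exp_mul_mgf s (neg_nonpos.2 hl) hYint
  rw [hind.mgf_sum hm] at key
  have hsum : {x | selectedSum f p a x ≤ s} = {x | (∑ j, Y j) x ≤ s} := by
    ext x; simp [selectedSum, hY]
  rw [hsum]
  refine key.trans ?_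
  calc Real.exp (- -l * s) * ∏ j, mgf (Y j) μ (-l)
      ≤ Real.exp (- -l * s) * ∏ j, Real.exp (-l * (p j * a j) + l ^ 2 * (p j * a j ^ 2)) := by
        gcongr with j _
        · intro j _; exact mgf_nonneg
        · exact hmgf j
    _ = _ := by
        rw [← Real.exp_sum, ← Real.exp_add, Finset.sum_add_distrib, ← Finset.mul_sum,
          ← Finset.mul_sum]
        congr 1; ring

/-- Markov's inequality for a sum of independent scaled Bernoulli variables. -/
lemma measure_le_selectedSum (hp0 : ∀ j, 0 ≤ p j) (hp1 : ∀ j, p j ≤ 1) (ha : ∀ j, 0 ≤ a j)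
    (s : ℝ) :
    s * (Measure.infinitePi fun _ : ℕ => (volume : Measure unitInterval)).real
      {x | s ≤ selectedSum f p a x} ≤ ∑ j, p j * a j := by
  set μ := Measure.infinitePi fun _ : ℕ => (volume : Measure unitInterval) with hμ
  have hint : ∀ j, Integrable (fun x : ℕ → unitInterval =>
      {u : unitInterval | (u : ℝ) < p j}.indicator (fun _ => a j) (x (f j))) μ := by
    intro j
    refine Integrable.of_bound ((measurable_indicator_lt_coe (p j) _).comp
      (measurable_pi_apply (f j))).aestronglyMeasurable (|a j|) (ae_of_all _ fun x => ?_)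
    by_cases hx : x (f j) ∈ {u : unitInterval | (u : ℝ) < p j}
    · simp [Set.indicator_of_mem hx]
    · simp [Set.indicator_of_notMem hx]
  refine (mul_meas_ge_le_integral_of_nonneg (ae_of_all _ fun x =>
    Finset.sum_nonneg fun j _ => Set.indicator_nonneg (fun _ _ => ha j) _)
    (integrable_finsetSum _ fun j _ => hint j) s).trans (le_of_eq ?_)
  rw [integral_finsetSum _ fun j _ => hint j]
  refine Finset.sum_congr rfl fun j _ => ?_
  have hev : (volume : Measure unitInterval) = μ.map (fun y => y (f j)) :=
    (Measure.infinitePi_map_eval (fun _ : ℕ => (volume : Measure unitInterval)) (f j)).symm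
  rw [← integral_map (φ := fun x : ℕ → unitInterval => x (f j))
        (measurable_pi_apply _).aemeasurable
    (measurable_indicator_lt_coe _ _).aestronglyMeasurable, ← hev,
    integral_indicator_const _ (measurableSet_lt_coe _), volume_lt_coe (hp0 j) (hp1 j), smul_eq_mul]

end selectedSum

/-! ### The median -/

lemma exists_sorted_median (l : List ℝ) : ∃ s : List ℝ, s.Perm l ∧ s.Pairwise (· ≤ ·) ∧
    median l = (s.getD ((s.length - 1) / 2) 0 + s.getD (s.length / 2) 0) / 2 :=
  ⟨_, l.perm_insertionSort (· ≤ ·), l.pairwise_insertionSort (· ≤ ·), rfl⟩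

lemma getD_le_getD_of_pairwise {s : List ℝ} (hs : s.Pairwise (· ≤ ·)) {i j : ℕ} (hij : i ≤ j)
    (hj : j < s.length) : s.getD i 0 ≤ s.getD j 0 := by
  rw [List.getD_eq_getElem _ _ (hij.trans_lt hj), List.getD_eq_getElem _ _ hj]
  rcases hij.eq_or_lt with rfl | h
  · exact le_rfl
  · exact List.pairwise_iff_getElem.1 hs _ _ _ _ h

/-- The median averages two middle entries, so only the lower one, at index `(length - 1) / 2`, must
be below `x`. It and its predecessors in the sorted list already make up half of the entries. -/
lemma length_le_of_median_lt {l : List ℝ} (hl : l ≠ []) {x : ℝ} (h : median l < x) :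
    l.length ≤ 2 * l.countP (fun y => y < x) := by
  obtain ⟨s, hp, hs, hm⟩ := exists_sorted_median l
  have hpos : 0 < s.length := by rw [hp.length_eq]; exact List.length_pos_iff.2 hl
  rw [hm] at h
  have h1 := getD_le_getD_of_pairwise hs (i := (s.length - 1) / 2) (j := s.length / 2)
    (by omega) (by omega)
  have h2 : ∀ y ∈ s.take ((s.length - 1) / 2 + 1), decide (y < x) = true := by
    intro y hy
    obtain ⟨i, hi, rfl⟩ := List.mem_iff_getElem.1 hy
    rw [List.length_take] at hi
    rw [List.getElem_take]
    have := getD_le_getD_of_pairwise hs (i := i) (j := (s.length - 1) / 2) (by omega) (by omega)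
    rw [List.getD_eq_getElem _ _ (by omega)] at this
    exact decide_eq_true (by linarith)
  have h3 := (List.take_sublist ((s.length - 1) / 2 + 1) s).countP_le (p := fun y => decide (y < x))
  rw [List.countP_eq_length.2 h2, List.length_take, hp.countP_eq] at h3
  rw [← hp.length_eq]
  omega

lemma length_le_of_lt_median {l : List ℝ} (hl : l ≠ []) {x : ℝ} (h : x < median l) :
    l.length ≤ 2 * l.countP (fun y => x < y) := by
  obtain ⟨s, hp, hs, hm⟩ := exists_sorted_median l
  have hpos : 0 < s.length := by rw [hp.length_eq]; exact List.length_pos_iff.2 hl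
  rw [hm] at h
  have h1 := getD_le_getD_of_pairwise hs (i := (s.length - 1) / 2) (j := s.length / 2)
    (by omega) (by omega)
  have h2 : ∀ y ∈ s.drop (s.length / 2), decide (x < y) = true := by
    intro y hy
    obtain ⟨i, hi, rfl⟩ := List.mem_iff_getElem.1 hy
    rw [List.length_drop] at hi
    rw [List.getElem_drop]
    have := getD_le_getD_of_pairwise hs (i := s.length / 2) (j := s.length / 2 + i)
      (by omega) (by omega)
    rw [List.getD_eq_getElem _ _ (by omega : s.length / 2 + i < s.length)] at this
    exact decide_eq_true (by linarith)
  have h3 := (List.drop_sublist (s.length / 2) s).countP_le (p := fun y => decide (x < y))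
  rw [List.countP_eq_length.2 h2, List.length_drop, hp.countP_eq] at h3
  rw [← hp.length_eq]
  omega

lemma countP_map_range_eq_sum (m : ℕ) (g : ℕ → ℝ) (P : ℝ → Prop) [DecidablePred P] :
    (((List.range m).map g).countP (fun y => P y) : ℝ) =
      ∑ k ∈ Finset.range m, if P (g k) then (1 : ℝ) else 0 := by
  induction m with
  | zero => simp
  | succ m ih =>
    rw [List.range_succ, List.map_append, List.countP_append, Finset.sum_range_succ, Nat.cast_add, ih]
    by_cases h : P (g m) <;> simp [h]

/-! ### Cauchy sketches -/

lemma injective_mul_add (N : ℕ) : Function.Injective fun kj : ℕ × Fin N => kj.1 * N + kj.2 := by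
  rintro ⟨k, j⟩ ⟨k', j'⟩ h
  have hN : 0 < N := j.pos
  have hd : ∀ (k : ℕ) (j : Fin N), (k * N + j) / N = k := fun k j => by
    rw [mul_comm, Nat.mul_add_div hN, Nat.div_eq_of_lt j.2, add_zero]
  have hk : k = k' := by rw [← hd k j, ← hd k' j']; exact congrArg (· / N) h
  subst hk
  simp only [add_right_inj] at h
  exact Prod.ext rfl (Fin.ext h)

/-- The blocks of length `N` of a sequence of independent variables. -/
lemma map_blocks_infinitePi (ν : Measure ℝ) [IsProbabilityMeasure ν] (N : ℕ) :
    (Measure.infinitePi fun _ : ℕ => ν).map (fun y k (j : Fin N) => y (k * N + j)) =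
      Measure.infinitePi fun _ : ℕ => Measure.infinitePi fun _ : Fin N => ν := by
  rw [← Measure.infinitePi_map_curry (fun (_ : ℕ) (_ : Fin N) => ν),
    ← Measure.map_infinitePi_infinitePi_of_inj (P := fun _ : ℕ => ν) (injective_mul_add N),
    Measure.map_map (by fun_prop) (by fun_prop)]
  rfl

/-- Row `k` of the sketch reads the `k`-th block of `N` Cauchy variables. The blocks are
independent, and by 1-stability each row is a Cauchy variable scaled by `∑ |w j|`, so the bound for
independent trials applies. -/
lemma measure_block_le (m N : ℕ) (w : Fin N → ℝ) {P : ℝ → Prop} [DecidablePred P]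
    (hP : MeasurableSet {x | P x}) {γ : ℝ} (hγ : 0 ≤ γ)
    (h : (cauchyMeasure 0 1).real {x | P |(∑ j, |w j|) * x|} ≤ 1 / 2 - γ) :
    (Measure.infinitePi fun _ : ℕ => cauchyMeasure 0 1).real
      {y | m ≤ 2 * ((List.range m).map fun k => |∑ j : Fin N, w j * y (k * N + j)|).countP
        (fun x => P x)} ≤ Real.exp (-(2 * γ ^ 2 * m)) := by
  set S : Set (Fin N → ℝ) := {e | P |∑ j, w j * e j|} with hS
  have hSm : MeasurableSet S :=
    (by fun_prop : Measurable fun e : Fin N → ℝ => |∑ j, w j * e j|) hP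
  have hν : (Measure.infinitePi fun _ : Fin N => cauchyMeasure 0 1).real S ≤ 1 / 2 - γ := by
    refine le_trans (le_of_eq ?_) h
    have h1 := map_sum_cauchy (f := fun j : Fin N => j) Function.injective_id w
    have hm : MeasurableSet {x : ℝ | P |x|} := measurable_id.abs hP
    have h2 := congrArg (fun κ : Measure ℝ => κ.real {x | P |x|}) h1
    simp only [measureReal_def] at h2 ⊢
    rwa [Measure.map_apply (by fun_prop) hm, Measure.map_apply (by fun_prop) hm] at h2
  refine le_trans ?_ (measure_half_trials_le _ hSm hγ hν m)
  rw [← map_blocks_infinitePi]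
  have hφ : Measurable fun (y : ℕ → ℝ) (k : ℕ) (j : Fin N) => y (k * N + j) := by fun_prop
  -- `Measure.le_map_apply` bounds the measure of a preimage without measurability of the target
  -- event.
  refine le_trans (measureReal_mono ?_) (ENNReal.toReal_mono (measure_ne_top _ _)
    (Measure.le_map_apply hφ.aemeasurable _))
  intro y hy
  simp only [Set.mem_ofPred_eq, Set.mem_preimage] at hy ⊢
  have hy' : (m : ℝ) ≤ 2 * (((List.range m).map fun k => |∑ j : Fin N, w j * y (k * N + j)|).countP
      (fun x => P x) : ℕ) := by exact_mod_cast hy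
  rw [countP_map_range_eq_sum] at hy'
  convert hy' using 3 with k _
  by_cases hk : P |∑ j : Fin N, w j * y (k * N + j)| <;> simp [hS, hk]

/-- The median of the absolute values of a Cauchy sketch approximates the `ℓ₁` norm. -/
lemma measure_sketch_le {m : ℕ} (hm : 0 < m) (N : ℕ) (w : Fin N → ℝ) {η : ℝ} (h0 : 0 ≤ η)
    (h1 : η ≤ 1) :
    (Measure.infinitePi fun _ : ℕ => cauchyMeasure 0 1).real
      {y | ¬ ((1 - η) * ∑ j, |w j| ≤
            median ((List.range m).map fun k => |∑ j : Fin N, w j * y (k * N + j)|) ∧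
          median ((List.range m).map fun k => |∑ j : Fin N, w j * y (k * N + j)|) ≤
            (1 + η) * ∑ j, |w j|)} ≤ 2 * Real.exp (-(2 * (η / 10) ^ 2 * m)) := by
  classical
  set R := ∑ j, |w j| with hR
  have hR0 : 0 ≤ R := Finset.sum_nonneg fun j _ => abs_nonneg _
  have hne : ∀ g : ℕ → ℝ, (List.range m).map g ≠ [] := fun g => by simp [hm.ne']
  have hA := measure_block_le m N w (P := fun x => x < (1 - η) * R) measurableSet_Iio
    (γ := η / 10) (by positivity) (by
      -- For `R = 0` the event is empty; otherwise dividing by `R` reduces it to a standard Cauchy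
      -- variable.
      rcases hR0.eq_or_lt with h | h
      · rw [← hR, ← h]; simp; linarith
      · rw [← hR]
        refine le_trans (measureReal_mono fun x hx => ?_) (cauchyMeasure_abs_lt h0 h1)
        simp only [Set.mem_ofPred_eq, abs_mul, abs_of_pos h] at hx ⊢
        nlinarith)
  have hB := measure_block_le m N w (P := fun x => (1 + η) * R < x) measurableSet_Ioi
    (γ := η / 10) (by positivity) (by
      rcases hR0.eq_or_lt with h | h
      · rw [← hR, ← h]; simp; linarith
      · rw [← hR]
        refine le_trans (measureReal_mono fun x hx => ?_) (cauchyMeasure_lt_abs h0 h1)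
        simp only [Set.mem_ofPred_eq, abs_mul, abs_of_pos h] at hx ⊢
        nlinarith)
  rw [two_mul (Real.exp _)]
  refine le_trans (le_trans (measureReal_mono ?_) (measureReal_union_le _ _)) (add_le_add hA hB)
  intro y hy
  simp only [Set.mem_ofPred_eq, not_and_or, not_le] at hy
  rcases hy with hy | hy
  · left
    simpa using length_le_of_median_lt (hne _) hy
  · right
    simpa using length_le_of_lt_median (hne _) hy

/-! ### Sampling probabilities -/

/-- In every finite family of vectors there is a subfamily, with as many members as the dimension of
the span, such that all vectors are linear combinations with coefficients in `[-1, 1]`. -/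
lemma exists_bounded_combination {ι V : Type*} [Finite ι] [AddCommGroup V] [Module ℝ V]
    [FiniteDimensional ℝ V] (v : ι → V) :
    ∃ s : Fin (Module.finrank ℝ (Submodule.span ℝ (Set.range v))) → ι, ∀ i,
      ∃ a : Fin (Module.finrank ℝ (Submodule.span ℝ (Set.range v))) → ℝ,
        (∀ k, |a k| ≤ 1) ∧ v i = ∑ k, a k • v (s k) := by
  classical
  set U := Submodule.span ℝ (Set.range v) with hU
  set r := Module.finrank ℝ U with hr
  let v' : ι → U := fun i => ⟨v i, Submodule.subset_span ⟨i, rfl⟩⟩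
  let e : Module.Basis (Fin r) ℝ U := Module.finBasis ℝ U
  obtain ⟨f, hf, hspan, hli⟩ := Submodule.exists_fun_fin_finrank_span_eq ℝ (Set.range v)
  choose s₀ hs₀ using hf
  have hs₀' : v ∘ s₀ = f := funext hs₀
  have hv' : ∀ s : Fin r → ι, Submodule.map U.subtype (Submodule.span ℝ (Set.range (v' ∘ s))) =
      Submodule.span ℝ (Set.range (v ∘ s)) := by
    intro s
    rw [Submodule.map_span, ← Set.range_comp]
    rfl
  -- Some subfamily is a basis of the span, so the maximal determinant is nonzero.
  have h0 : IsUnit (e.det (v' ∘ s₀)) := by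
    rw [← e.is_basis_iff_det]
    constructor
    · refine LinearIndependent.of_comp U.subtype ?_
      have : U.subtype ∘ (v' ∘ s₀) = f := hs₀'
      rw [this]; exact hli
    · apply Submodule.map_injective_of_injective U.subtype_injective
      rw [hv', hs₀', hspan, Submodule.map_top, Submodule.range_subtype]
  have : Nonempty (Fin r → ι) := ⟨s₀⟩
  obtain ⟨s, hs⟩ := Finite.exists_max fun s : Fin r → ι => |e.det (v' ∘ s)|
  have hpos : 0 < |e.det (v' ∘ s)| := (abs_pos.2 h0.ne_zero).trans_le (hs s₀)
  obtain ⟨hli', hsp'⟩ := e.is_basis_iff_det.2 (abs_pos.1 hpos).isUnit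
  refine ⟨s, fun i => ⟨fun k => (Module.Basis.mk hli' hsp'.ge).coord k (v' i), fun k => ?_, ?_⟩⟩
  -- Cramer's rule: the `k`-th coefficient is the determinant with the `k`-th vector replaced by `v
  -- i`, divided by the maximal determinant.
  · have h1 := congrArg (fun φ => φ (v' i)) (e.det_smul_mk_coord_eq_det_update hli' hsp'.ge k)
    have h2 : e.det.toMultilinearMap.toLinearMap (v' ∘ s) k (v' i) =
        e.det (v' ∘ Function.update s k i) := by
      rw [Function.comp_update]; rfl
    rw [h2] at h1
    have h3 := hs (Function.update s k i)
    rw [← h1, LinearMap.smul_apply, smul_eq_mul, abs_mul] at h3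
    exact le_of_mul_le_mul_left (by linarith) hpos
  · have h1 := (Module.Basis.mk hli' hsp'.ge).sum_repr (v' i)
    have h2 := congrArg U.subtype h1
    rw [map_sum] at h2
    simpa [v'] using h2.symm

/-- The pairs of indices over which the maximum in the sampling probability is taken. -/
def pairs (n : ℕ) : List (Fin n × Fin n) :=
  (List.finRange n ×ˢ List.finRange n).filter fun ij => ij.1 < ij.2

/-- The sampling probability of a coordinate as a real number. -/
noncomputable def coordProb {n d : ℕ} (c : Fin n → Fin d → ℝ) (b : Fin d) : ℝ :=
  ((pairs n).map fun ij => |c ij.1 b - c ij.2 b| / ∑ b', |c ij.1 b' - c ij.2 b'|).foldr max 0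

lemma foldr_max_le {l : List ℝ} {M : ℝ} (hM : 0 ≤ M) (h : ∀ x ∈ l, x ≤ M) :
    l.foldr max 0 ≤ M := by
  induction l with
  | nil => exact hM
  | cons a l ih =>
    exact max_le (h a (by simp)) (ih fun x hx => h x (by simp [hx]))

lemma le_foldr_max {l : List ℝ} {x : ℝ} (h : x ∈ l) : x ≤ l.foldr max 0 := by
  induction l with
  | nil => simp at h
  | cons a l ih =>
    rcases List.mem_cons.1 h with rfl | h
    · exact le_max_left _ _
    · exact (ih h).trans (le_max_right _ _)

lemma foldr_max_nonneg (l : List ℝ) : 0 ≤ l.foldr max 0 := by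
  induction l with
  | nil => exact le_rfl
  | cons a l ih => exact ih.trans (le_max_right _ _)

section coordProb

variable {n d : ℕ} (c : Fin n → Fin d → ℝ)

lemma coordProb_nonneg (b : Fin d) : 0 ≤ coordProb c b := foldr_max_nonneg _

lemma coordProb_le {b : Fin d} {M : ℝ} (hM : 0 ≤ M)
    (h : ∀ i j, |c i b - c j b| / ∑ b', |c i b' - c j b'| ≤ M) : coordProb c b ≤ M := by
  refine foldr_max_le hM fun x hx => ?_
  obtain ⟨ij, -, rfl⟩ := List.mem_map.1 hx
  exact h _ _

lemma abs_sub_le_sum (i j : Fin n) (b : Fin d) : |c i b - c j b| ≤ ∑ b', |c i b' - c j b'| :=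
  Finset.single_le_sum (f := fun b' => |c i b' - c j b'|) (fun _ _ => abs_nonneg _)
    (Finset.mem_univ b)

lemma coordProb_le_one (b : Fin d) : coordProb c b ≤ 1 :=
  coordProb_le c zero_le_one fun i j =>
    div_le_one_of_le₀ (abs_sub_le_sum c i j b) (Finset.sum_nonneg fun _ _ => abs_nonneg _)

/-- The definition covers only `i < j`; the rest follows by symmetry. If the two points coincide,
both sides vanish, so the junk value of division by zero does no harm. -/
lemma abs_sub_le_coordProb_mul (i j : Fin n) (b : Fin d) :
    |c i b - c j b| ≤ coordProb c b * ∑ b', |c i b' - c j b'| := by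
  have key : ∀ i j : Fin n, i < j → |c i b - c j b| ≤ coordProb c b * ∑ b', |c i b' - c j b'| := by
    intro i j hij
    rcases (Finset.sum_nonneg fun b' _ => abs_nonneg (c i b' - c j b') :
      0 ≤ ∑ b', |c i b' - c j b'|).eq_or_lt with h | h
    · rw [← h, mul_zero, h]
      exact abs_sub_le_sum c i j b
    · rw [← div_le_iff₀ h]
      refine le_foldr_max (List.mem_map.2 ⟨(i, j), ?_, rfl⟩)
      simp [pairs, hij]
  rcases lt_trichotomy i j with h | rfl | h
  · exact key i j h
  · simp
  · simpa only [abs_sub_comm] using key j i h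

/-- The sum of the sampling probabilities of all coordinates is at most the number of points. -/
lemma sum_coordProb_le : ∑ b, coordProb c b ≤ n := by
  let v : Fin n × Fin n → Fin d → ℝ := fun ij => (∑ b', |c ij.1 b' - c ij.2 b'|)⁻¹ • (c ij.1 - c ij.2)
  obtain ⟨s, hs⟩ := exists_bounded_combination v
  have habs : ∀ ij b, |v ij b| = |c ij.1 b - c ij.2 b| / ∑ b', |c ij.1 b' - c ij.2 b'| := by
    intro ij b
    simp only [v, Pi.smul_apply, Pi.sub_apply, smul_eq_mul, abs_mul, abs_inv]
    rw [abs_of_nonneg (Finset.sum_nonneg fun _ _ => abs_nonneg _), div_eq_inv_mul]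
  have hnorm : ∀ ij, ∑ b, |v ij b| ≤ 1 := by
    intro ij
    simp_rw [habs]
    rw [← Finset.sum_div]
    exact div_self_le_one _
  -- All differences lie in the span of the `n` points.
  have hrank : Module.finrank ℝ (Submodule.span ℝ (Set.range v)) ≤ n := by
    have hle : Submodule.span ℝ (Set.range v) ≤ Submodule.span ℝ (Set.range c) := by
      rw [Submodule.span_le]
      rintro _ ⟨ij, rfl⟩
      exact Submodule.smul_mem _ _ (Submodule.sub_mem _ (Submodule.subset_span ⟨_, rfl⟩)
        (Submodule.subset_span ⟨_, rfl⟩))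
    refine (Submodule.finrank_mono hle).trans ?_
    simpa [Set.finrank] using finrank_range_le_card (R := ℝ) c
  have hb : ∀ b, coordProb c b ≤ ∑ k, |v (s k) b| := by
    intro b
    refine coordProb_le c (Finset.sum_nonneg fun _ _ => abs_nonneg _) fun i j => ?_
    rw [← habs (i, j)]
    obtain ⟨a, ha, hv⟩ := hs (i, j)
    rw [hv, Finset.sum_apply]
    refine (Finset.abs_sum_le_sum_abs _ _).trans (Finset.sum_le_sum fun k _ => ?_)
    rw [Pi.smul_apply, smul_eq_mul, abs_mul]
    exact mul_le_of_le_one_left (abs_nonneg _) (ha k)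
  calc ∑ b, coordProb c b ≤ ∑ b, ∑ k, |v (s k) b| := Finset.sum_le_sum fun b _ => hb b
    _ = ∑ k, ∑ b, |v (s k) b| := Finset.sum_comm
    _ ≤ ∑ _k : Fin (Module.finrank ℝ (Submodule.span ℝ (Set.range v))), (1 : ℝ) :=
        Finset.sum_le_sum fun k _ => hnorm _
    _ ≤ n := by simpa using hrank

end coordProb

/-! ### Semantics of the programs -/

/-- Started after `u` uniform and `v` Cauchy draws, the program ends after `u'` and `v'` draws with
the result `a`, and makes at most `t` steps. -/
def Eval {α : Type} (ω : Tape) (p : Prog ℝ α) (u v : ℕ) (a : α) (u' v' t : ℕ) : Prop :=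
  ∀ st, ∃ t' ≤ t, p.run ω ⟨u, v, st⟩ = (a, ⟨u', v', st + t'⟩)

/-- A program that makes no random draws. -/
def EvalDet {α : Type} (ω : Tape) (p : Prog ℝ α) (a : α) (t : ℕ) : Prop :=
  ∀ u v, Eval ω p u v a u v t

lemma Prog.run_bind {α β : Type} (ω : Tape) (p : Prog ℝ α) (g : α → Prog ℝ β) (s : Counters) :
    (p >>= g).run ω s = (g (p.run ω s).1).run ω (p.run ω s).2 := by
  change (p.bind g).run ω s = _
  induction p generalizing s with
  | ret a => rfl
  | nat k next ih => exact ih _ _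
  | unary f x next ih => exact ih _ _
  | binary f x y next ih => exact ih _ _
  | less x y next ih => exact ih _ _
  | ceil x next ih => exact ih _ _
  | uniform next ih => exact ih _ _
  | cauchy next ih => exact ih _ _

section Eval

variable {α β : Type} {ω : Tape} {u v u' v' u'' v'' t t' : ℕ}

lemma Eval.bind {p : Prog ℝ α} {g : α → Prog ℝ β} {a : α} {b : β} (h : Eval ω p u v a u' v' t)
    (h' : Eval ω (g a) u' v' b u'' v'' t') : Eval ω (p >>= g) u v b u'' v'' (t + t') := by
  intro st
  obtain ⟨t₁, ht₁, h₁⟩ := h st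
  obtain ⟨t₂, ht₂, h₂⟩ := h' (st + t₁)
  exact ⟨t₁ + t₂, by omega, by rw [Prog.run_bind, h₁, h₂, add_assoc]⟩

lemma Eval.mono {p : Prog ℝ α} {a : α} (h : Eval ω p u v a u' v' t) (ht : t ≤ t') :
    Eval ω p u v a u' v' t' := by
  intro st
  obtain ⟨t₁, ht₁, h₁⟩ := h st
  exact ⟨t₁, ht₁.trans ht, h₁⟩

lemma Eval.pure (a : α) : Eval ω (Pure.pure a) u v a u v 0 := fun _ => ⟨0, le_rfl, rfl⟩

lemma EvalDet.bind {p : Prog ℝ α} {g : α → Prog ℝ β} {a : α} {b : β} (h : EvalDet ω p a t)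
    (h' : EvalDet ω (g a) b t') : EvalDet ω (p >>= g) b (t + t') :=
  fun u v => (h u v).bind (h' u v)

lemma EvalDet.mono {p : Prog ℝ α} {a : α} (h : EvalDet ω p a t) (ht : t ≤ t') :
    EvalDet ω p a t' := fun u v => (h u v).mono ht

lemma EvalDet.pure (a : α) : EvalDet ω (Pure.pure a) a 0 := fun _ _ => Eval.pure a

lemma evalDet_natConst (k : ℕ) : EvalDet ω (natConst k) (k : ℝ) 1 :=
  fun _ _ _ => ⟨1, le_rfl, rfl⟩

lemma evalDet_logOp (x : ℝ) : EvalDet ω (logOp x) (Real.log x) 1 := fun _ _ _ => ⟨1, le_rfl, rfl⟩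
lemma evalDet_absOp (x : ℝ) : EvalDet ω (absOp x) |x| 1 := fun _ _ _ => ⟨1, le_rfl, rfl⟩
lemma evalDet_addOp (x y : ℝ) : EvalDet ω (addOp x y) (x + y) 1 := fun _ _ _ => ⟨1, le_rfl, rfl⟩
lemma evalDet_subOp (x y : ℝ) : EvalDet ω (subOp x y) (x - y) 1 := fun _ _ _ => ⟨1, le_rfl, rfl⟩
lemma evalDet_mulOp (x y : ℝ) : EvalDet ω (mulOp x y) (x * y) 1 := fun _ _ _ => ⟨1, le_rfl, rfl⟩
lemma evalDet_divOp (x y : ℝ) : EvalDet ω (divOp x y) (x / y) 1 := fun _ _ _ => ⟨1, le_rfl, rfl⟩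
lemma evalDet_maxOp (x y : ℝ) : EvalDet ω (maxOp x y) (max x y) 1 := fun _ _ _ => ⟨1, le_rfl, rfl⟩

lemma evalDet_lessOp (x y : ℝ) : EvalDet ω (lessOp x y) (decide (x < y)) 1 :=
  fun _ _ _ => ⟨1, le_rfl, rfl⟩

lemma evalDet_ceilOp (x : ℝ) : EvalDet ω (ceilOp x) ⌈x⌉₊ (⌈x⌉₊ + 1) :=
  fun _ _ _ => ⟨⌈x⌉₊ + 1, le_rfl, rfl⟩

lemma eval_drawUniform : Eval ω drawUniform u v (ω.1 u : ℝ) (u + 1) v 1 :=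
  fun _ => ⟨1, le_rfl, rfl⟩

lemma eval_drawCauchy : Eval ω drawCauchy u v (ω.2 v) u (v + 1) 1 :=
  fun _ => ⟨1, le_rfl, rfl⟩

lemma EvalDet.forEach {f : α → Prog ℝ β} {g : α → β} {l : List α}
    (h : ∀ a ∈ l, EvalDet ω (f a) (g a) t) :
    EvalDet ω (forEach f l) (l.map g) (l.length * t) := by
  induction l with
  | nil => exact (EvalDet.pure _).mono (by simp)
  | cons a l ih =>
    refine EvalDet.mono (t := t + (l.length * t + 0)) ?_ (by rw [List.length_cons]; linarith)
    refine EvalDet.bind (h a (by simp)) ?_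
    refine EvalDet.bind (ih fun b hb => h b (by simp [hb])) ?_
    exact EvalDet.pure _

/-- The sequences `x` and `y` record the draw counters before each call, so that the `i`-th result
may be expressed by the tape entries that this call consumes. -/
lemma Eval.forEach {f : α → Prog ℝ β} (l : List α) (g : ℕ → β) (x y : ℕ → ℕ)
    (h : ∀ i (hi : i < l.length), Eval ω (f l[i]) (x i) (y i) (g i) (x (i + 1)) (y (i + 1)) t) :
    Eval ω (forEach f l) (x 0) (y 0) ((List.range l.length).map g) (x l.length) (y l.length)
      (l.length * t) := by
  induction l generalizing g x y with
  | nil => exact (Eval.pure _).mono (by simp)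
  | cons a l ih =>
    have h0 := h 0 (by simp)
    have h1 := ih (fun i => g (i + 1)) (fun i => x (i + 1)) (fun i => y (i + 1))
      fun i hi => h (i + 1) (by simpa using hi)
    have e : (List.range (a :: l).length).map g =
        g 0 :: (List.range l.length).map fun i => g (i + 1) := by
      rw [List.length_cons, List.range_succ_eq_map, List.map_cons, List.map_map]
      rfl
    rw [e]
    refine Eval.mono (t := t + (l.length * t + 0)) ?_ (by rw [List.length_cons]; linarith)
    refine Eval.bind h0 ?_
    refine Eval.bind h1 ?_
    exact Eval.pure _

lemma evalDet_sumList (l : List ℝ) : EvalDet ω (sumList l) l.sum (l.length + 1) := by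
  induction l with
  | nil =>
    rw [List.sum_nil, ← Nat.cast_zero]
    exact evalDet_natConst 0
  | cons a l ih =>
    rw [List.sum_cons]
    exact EvalDet.bind ih (evalDet_addOp _ _)

lemma evalDet_maxList (l : List ℝ) : EvalDet ω (maxList l) (l.foldr max 0) (l.length + 1) := by
  induction l with
  | nil =>
    rw [List.foldr_nil, ← Nat.cast_zero]
    exact evalDet_natConst 0
  | cons a l ih => exact EvalDet.bind ih (evalDet_maxOp _ _)

lemma evalDet_absDiff (x y : ℝ) : EvalDet ω (absDiff x y) |x - y| 2 :=
  (evalDet_subOp x y).bind (evalDet_absOp _)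

lemma evalDet_l1Dist {d : ℕ} (x y : Fin d → ℝ) :
    EvalDet ω (l1Dist x y) (∑ b, |x b - y b|) (3 * d + 1) := by
  have h := (EvalDet.forEach (ω := ω) (l := List.finRange d) (f := fun b => absDiff (x b) (y b))
    (fun b _ => evalDet_absDiff (x b) (y b))).bind (evalDet_sumList _)
  have e : ((List.finRange d).map fun b => |x b - y b|).sum = ∑ b, |x b - y b| := by
    rw [← List.ofFn_eq_map, List.sum_ofFn]
  rw [e] at h
  exact h.mono (by simp; omega)

lemma evalDet_dotProd (x y : List ℝ) :
    EvalDet ω (dotProd x y) (List.zipWith (· * ·) x y).sum (2 * x.length + 1) := by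
  have h := (EvalDet.forEach (ω := ω) (l := x.zip y) (f := fun z : ℝ × ℝ => mulOp z.1 z.2)
    (fun z _ => evalDet_mulOp z.1 z.2)).bind (evalDet_sumList _)
  have e : (x.zip y).map (fun z => z.1 * z.2) = List.zipWith (· * ·) x y := by
    rw [List.zip, List.map_zipWith]
  rw [e] at h
  exact h.mono (by simp; omega)

lemma length_pairs_le (n : ℕ) : (pairs n).length ≤ n ^ 2 := by
  refine (List.length_filter_le _ _).trans (le_of_eq ?_)
  rw [List.length_product, List.length_finRange, sq]

lemma evalDet_samplingProb {n d : ℕ} (c : Fin n → Fin d → ℝ) (b : Fin d) :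
    EvalDet ω (samplingProb c b) (coordProb c b) (n ^ 2 * (3 * d + 5) + 1) := by
  refine EvalDet.mono (t := (pairs n).length * (2 + (3 * d + 1 + 1)) + ((pairs n).length + 1)) ?_
    (by nlinarith [length_pairs_le n])
  refine EvalDet.bind (EvalDet.forEach (l := pairs n)
    (g := fun ij => |c ij.1 b - c ij.2 b| / ∑ b', |c ij.1 b' - c ij.2 b'|) fun ij _ => ?_) ?_
  · refine EvalDet.bind (evalDet_absDiff _ _) ?_
    refine EvalDet.bind (evalDet_l1Dist _ _) ?_
    exact evalDet_divOp _ _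
  · have h := evalDet_maxList (ω := ω) ((pairs n).map
      fun ij => |c ij.1 b - c ij.2 b| / ∑ b', |c ij.1 b' - c ij.2 b'|)
    rwa [List.length_map] at h

lemma evalDet_parameter (C n r : ℕ) (ε δ : ℝ) (hr : r ≤ 3) :
    EvalDet ω (parameter C n r ε δ) ⌈C * Real.log (n / δ) / (ε ^ r * δ ^ 2)⌉₊
      (⌈C * Real.log (n / δ) / (ε ^ r * δ ^ 2)⌉₊ + 13) := by
  have hfold : ∀ (r : ℕ) (e : ℝ),
      EvalDet ω ((List.replicate r ε).foldlM mulOp e) (e * ε ^ r) r := by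
    intro r
    induction r with
    | zero => intro e; simpa using EvalDet.pure e
    | succ r ih =>
      intro e
      rw [List.replicate_succ, List.foldlM_cons]
      rw [pow_succ', ← mul_assoc, Nat.add_comm]
      exact EvalDet.bind (evalDet_mulOp e ε) (ih (e * ε))
  have e : ((1 : ℕ) : ℝ) * ε ^ r * δ * δ = ε ^ r * δ ^ 2 := by push_cast; ring
  rw [← e]
  refine EvalDet.mono (t := 1 + (1 + (1 + (1 + (1 + (1 + (r + (1 + (1 + (1 +
    (⌈C * Real.log (n / δ) / (((1 : ℕ) : ℝ) * ε ^ r * δ * δ)⌉₊ + 1))))))))))) ?_ (by omega)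
  refine EvalDet.bind (evalDet_natConst C) ?_
  refine EvalDet.bind (evalDet_natConst n) ?_
  refine EvalDet.bind (evalDet_divOp _ _) ?_
  refine EvalDet.bind (evalDet_logOp _) ?_
  refine EvalDet.bind (evalDet_mulOp _ _) ?_
  refine EvalDet.bind (evalDet_natConst 1) ?_
  refine EvalDet.bind (hfold r _) ?_
  refine EvalDet.bind (evalDet_mulOp _ _) ?_
  refine EvalDet.bind (evalDet_mulOp _ _) ?_
  refine EvalDet.bind (evalDet_divOp _ _) ?_
  exact evalDet_ceilOp _

/-- `zipIdx u` attaches to each entry the index of the uniform variable that decides its fate. -/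
lemma eval_select (l : List (α × ℝ)) :
    Eval ω (select (fun bp : α × ℝ => do
        let u ← drawUniform
        lessOp u bp.2) l) u v
      (((l.zipIdx u).filter fun x => decide ((ω.1 x.2 : ℝ) < x.1.2)).map Prod.fst)
      (u + l.length) v (l.length * 2) := by
  induction l generalizing u with
  | nil => exact (Eval.pure _).mono (by simp)
  | cons a l ih =>
    have e : ((((a :: l).zipIdx u).filter fun x => decide ((ω.1 x.2 : ℝ) < x.1.2)).map Prod.fst) =
        if decide ((ω.1 u : ℝ) < a.2) = true then
          a :: (((l.zipIdx (u + 1)).filter fun x => decide ((ω.1 x.2 : ℝ) < x.1.2)).map Prod.fst)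
        else (((l.zipIdx (u + 1)).filter fun x => decide ((ω.1 x.2 : ℝ) < x.1.2)).map Prod.fst) := by
      rw [List.zipIdx_cons, List.filter_cons]
      split_ifs <;> simp
    rw [e, List.length_cons, ← Nat.add_assoc, Nat.add_right_comm]
    refine Eval.mono (t := (1 + 1) + (l.length * 2 + 0)) ?_ (by omega)
    refine Eval.bind (u' := u + 1) (v' := v) (a := decide ((ω.1 u : ℝ) < a.2)) ?_ ?_
    · exact Eval.bind eval_drawUniform (evalDet_lessOp _ _ _ _)
    · exact Eval.bind (ih (u := u + 1)) (Eval.pure _)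

end Eval

/-- The coordinates that are kept in some round, listed with repetitions. -/
def sampled {T d : ℕ} (κ : Fin T → Fin d → Bool) : List (Fin d) :=
  (List.finRange T).flatMap fun t => (List.finRange d).filter (κ t)

/-- The choices made in the first phase of the preprocessing. -/
noncomputable def choices {d : ℕ} (T : ℕ) (p : Fin d → ℝ) (x : ℕ → unitInterval) :
    Fin T → Fin d → Bool :=
  fun t b => decide ((x (t * d + b) : ℝ) < p b)

/-- The memory that results from the coordinate list `L` and the Cauchy variables `y`. -/
noncomputable def memoryOf {n d : ℕ} (c : Fin n → Fin d → ℝ) (p : Fin d → ℝ) (L : List (Fin d))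
    (m : ℕ) (y : ℕ → ℝ) : Memory ℝ n d where
  coords := L
  probs := L.map p
  matrix := (List.range m).map fun k => (List.range L.length).map fun j => y (k * L.length + j)
  sketch := fun i => ((List.range m).map fun k =>
    (List.range L.length).map fun j => y (k * L.length + j)).map fun row =>
      (List.zipWith (· * ·) row (L.map fun b => c i b / p b)).sum

lemma length_sampled_le {T d : ℕ} (κ : Fin T → Fin d → Bool) : (sampled κ).length ≤ T * d := by
  rw [sampled, List.length_flatMap]
  refine (List.sum_le_card_nsmul _ d fun x hx => ?_).trans (by simp)
  obtain ⟨t, -, rfl⟩ := List.mem_map.1 hx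
  exact (List.length_filter_le _ _).trans (by simp)

lemma zipIdx_finRange_map {d : ℕ} (p : Fin d → ℝ) (u : ℕ) :
    ((List.finRange d).map fun b => (b, p b)).zipIdx u =
      (List.finRange d).map fun b => ((b, p b), u + (b : ℕ)) := by
  apply List.ext_getElem
  · simp
  · intro i h₁ h₂
    simp

/-- Uniform variable `t * d + b` decides coordinate `b` in round `t`, and Cauchy variable `k * N +
j` is the matrix entry `(k, j)`. With these addresses the memory is an explicit function of the
tape, and the step bound is the sum of the costs of the phases. -/
lemma preprocess_eval {n d : ℕ} (A B : ℕ) (c : Fin n → Fin d → ℝ) (ε δ : ℝ) (ω : Tape) {T m N : ℕ}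
    (hT : T = ⌈A * Real.log (n / δ) / (ε ^ 3 * δ ^ 2)⌉₊)
    (hm : m = ⌈B * Real.log (n / δ) / (ε ^ 2 * δ ^ 2)⌉₊)
    (hN : N = (sampled (choices T (coordProb c) ω.1)).length) :
    Eval ω (preprocess A B c ε δ) 0 0
      (memoryOf c (coordProb c) (sampled (choices T (coordProb c) ω.1)) m ω.2) (T * d) (m * N)
      (T + 13 + (m + 13 + (d * (n ^ 2 * (3 * d + 5) + 1) + (T * (d * 2) + (m * N +
        n * (N + m * (2 * N + 1))))))) := by
  set L := sampled (choices T (coordProb c) ω.1) with hL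
  have h1 := evalDet_parameter (ω := ω) A n 3 ε δ le_rfl 0 0
  have h2 := evalDet_parameter (ω := ω) B n 2 ε δ (by norm_num) 0 0
  rw [← hT] at h1
  rw [← hm] at h2
  have h3 : Eval ω (forEach (fun b => do
      let p ← samplingProb c b
      pure (b, p)) (List.finRange d)) 0 0 ((List.finRange d).map fun b => (b, coordProb c b)) 0 0
      (d * (n ^ 2 * (3 * d + 5) + 1)) := by
    refine (EvalDet.forEach (l := List.finRange d) (g := fun b => (b, coordProb c b))
      (fun b _ => (evalDet_samplingProb c b).bind (EvalDet.pure (b, _))) 0 0).mono ?_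
    simp
  have h4 : Eval ω (forEach (fun _ => select (fun bp : Fin d × ℝ => do
      let u ← drawUniform
      lessOp u bp.2) ((List.finRange d).map fun b => (b, coordProb c b))) (List.range T)) 0 0
      ((List.range T).map fun t => ((List.finRange d).filter fun b : Fin d =>
        decide ((ω.1 (t * d + b) : ℝ) < coordProb c b)).map fun b => (b, coordProb c b))
      (T * d) 0 (T * (d * 2)) := by
    have h := Eval.forEach (ω := ω) (t := d * 2) (f := fun _ : ℕ => select (fun bp : Fin d × ℝ => do
      let u ← drawUniform
      lessOp u bp.2) ((List.finRange d).map fun b => (b, coordProb c b))) (List.range T)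
      (fun t => ((List.finRange d).filter fun b : Fin d =>
        decide ((ω.1 (t * d + b) : ℝ) < coordProb c b)).map fun b => (b, coordProb c b))
      (fun t => t * d) (fun _ => 0) (fun i hi => by
        have := eval_select (ω := ω) (u := i * d) (v := 0)
          ((List.finRange d).map fun b => (b, coordProb c b))
        rw [zipIdx_finRange_map, List.filter_map, List.map_map, List.length_map,
          List.length_finRange] at this
        rw [Nat.succ_mul]
        exact this)
    simpa using h
  have hflat : ((List.range T).map fun t => ((List.finRange d).filter fun b : Fin d =>
        decide ((ω.1 (t * d + b) : ℝ) < coordProb c b)).map fun b => (b, coordProb c b)).flatten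
      = L.map fun b => (b, coordProb c b) := by
    rw [hL, sampled, List.map_flatMap, ← List.map_coe_finRange_eq_range, List.map_map,
      List.flatMap_def]
    rfl
  have h5 : Eval ω (forEach (fun _ => forEach (fun _ => drawCauchy)
      (L.map fun b => (b, coordProb c b))) (List.range m)) (T * d) 0
      ((List.range m).map fun k => (List.range N).map fun j => ω.2 (k * N + j))
      (T * d) (m * N) (m * N) := by
    have h := Eval.forEach (ω := ω) (t := N) (f := fun _ : ℕ => forEach (fun _ => drawCauchy)
      (L.map fun b => (b, coordProb c b))) (List.range m)
      (fun k => (List.range N).map fun j => ω.2 (k * N + j))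
      (fun _ => T * d) (fun k => k * N) (fun i hi => by
        have := Eval.forEach (ω := ω) (t := 1) (f := fun _ : Fin d × ℝ => drawCauchy)
          (L.map fun b => (b, coordProb c b)) (fun j => ω.2 (i * N + j)) (fun _ => T * d)
          (fun j => i * N + j) (fun j hj => eval_drawCauchy)
        rw [List.length_map, ← hN] at this
        rw [Nat.succ_mul]
        exact this.mono (by omega))
    simpa using h
  have h6 : EvalDet ω (forEach (fun i => do
      let r ← forEach (fun bp : Fin d × ℝ => divOp (c i bp.1) bp.2)
        (L.map fun b => (b, coordProb c b))
      forEach (fun row => dotProd row r)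
        ((List.range m).map fun k => (List.range N).map fun j => ω.2 (k * N + j)))
      (List.finRange n))
      ((List.finRange n).map fun i => ((List.range m).map fun k =>
        (List.range N).map fun j => ω.2 (k * N + j)).map fun row =>
          (List.zipWith (· * ·) row (L.map fun b => c i b / coordProb c b)).sum)
      (n * (N + m * (2 * N + 1))) := by
    refine (EvalDet.forEach (l := List.finRange n) (t := N + m * (2 * N + 1)) fun i _ => ?_).mono
      (by simp)
    have e : (L.map fun b => (b, coordProb c b)).map (fun bp => c i bp.1 / bp.2) =
        L.map fun b => c i b / coordProb c b := by rw [List.map_map]; rfl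
    have ha := EvalDet.forEach (ω := ω) (l := L.map fun b => (b, coordProb c b)) (t := 1)
      (f := fun bp : Fin d × ℝ => divOp (c i bp.1) bp.2) fun bp _ => evalDet_divOp _ _
    rw [e] at ha
    rw [List.length_map, ← hN, mul_one] at ha
    refine EvalDet.bind ha ?_
    refine EvalDet.mono (t := ((List.range m).map fun k =>
      (List.range N).map fun j => ω.2 (k * N + j)).length * (2 * N + 1)) ?_ (by simp)
    refine EvalDet.forEach (t := 2 * N + 1) fun row hrow => ?_
    obtain ⟨k, -, rfl⟩ := List.mem_map.1 hrow
    exact (evalDet_dotProd _ _).mono (by simp)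
  refine Eval.bind h1 ?_
  refine Eval.bind h2 ?_
  refine Eval.bind h3 ?_
  refine Eval.bind h4 ?_
  rw [hflat]
  refine Eval.bind h5 ?_
  refine Eval.mono (t := n * (N + m * (2 * N + 1)) + 0) ?_ le_rfl
  refine Eval.bind (h6 _ _) ?_
  have hmem : memoryOf c (coordProb c) L m ω.2 =
      { coords := (L.map fun b => (b, coordProb c b)).map Prod.fst
        probs := (L.map fun b => (b, coordProb c b)).map Prod.snd
        matrix := (List.range m).map fun k => (List.range N).map fun j => ω.2 (k * N + j)
        sketch := fun i => ((List.finRange n).map fun i => ((List.range m).map fun k =>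
          (List.range N).map fun j => ω.2 (k * N + j)).map fun row =>
            (List.zipWith (· * ·) row (L.map fun b => c i b / coordProb c b)).sum).getD i [] } := by
    subst hN
    rw [memoryOf]
    congr 1
    · simp [Function.comp_def]
    · simp [Function.comp_def]
    · funext i
      rw [List.getD_eq_getElem _ _ (by simp)]
      simp
  rw [hmem]
  exact Eval.pure _

/-! ### Queries -/

/-- The estimate of the distance of `c i` and `q` that the query procedure computes. -/
noncomputable def estimate {n d : ℕ} (c : Fin n → Fin d → ℝ) (p q : Fin d → ℝ) (L : List (Fin d))
    (m : ℕ) (y : ℕ → ℝ) (i : Fin n) : ℝ :=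
  median ((List.range m).map fun k =>
    |∑ j : Fin L.length, (c i L[j] - q L[j]) / p L[j] * y (k * L.length + j)|)

lemma sum_zipWith_mul_range_map {β : Type*} (L : List β) (a : ℕ → ℝ) (g : β → ℝ) :
    (List.zipWith (· * ·) ((List.range L.length).map a) (L.map g)).sum =
      ∑ j : Fin L.length, a j * g L[j] := by
  have : List.zipWith (· * ·) ((List.range L.length).map a) (L.map g) =
      List.ofFn fun j : Fin L.length => a j * g L[j] := by
    apply List.ext_getElem
    · simp
    · intro i h₁ h₂
      simp
  rw [this, List.sum_ofFn]

/-- Linearity of the sketch: `M rᵢ - M u = M (rᵢ - u)`. -/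
lemma query_memoryOf {n d : ℕ} (c : Fin n → Fin d → ℝ) (p q : Fin d → ℝ) (L : List (Fin d))
    (m : ℕ) (y : ℕ → ℝ) :
    query (memoryOf c p L m y) q = (List.finRange n).argmin (estimate c p q L m y) := by
  have hu : List.zipWith (· / ·) (L.map q) (L.map p) = L.map fun b => q b / p b := by
    rw [List.zipWith_map, List.zipWith_self]
  have h : ∀ i, median (List.zipWith (fun x y => |x - y|) ((memoryOf c p L m y).sketch i)
      ((memoryOf c p L m y).matrix.map fun row =>
        (List.zipWith (· * ·) row (List.zipWith (· / ·) (L.map q) (L.map p))).sum)) =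
      estimate c p q L m y i := by
    intro i
    rw [hu, estimate]
    simp only [memoryOf, List.map_map]
    rw [List.zipWith_map, List.zipWith_self]
    congr 1
    refine List.map_congr_left fun k _ => ?_
    simp only [Function.comp_apply, sum_zipWith_mul_range_map]
    rw [← Finset.sum_sub_distrib]
    congr 1
    refine Finset.sum_congr rfl fun j _ => ?_
    ring
  rw [query, answer]
  congr 1
  funext i
  exact h i

lemma exists_argmin_finRange {n : ℕ} (hn : 0 < n) (f : Fin n → ℝ) :
    ∃ i, (List.finRange n).argmin f = some i ∧ ∀ j, f i ≤ f j := by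
  cases h : (List.finRange n).argmin f with
  | none =>
    rw [List.argmin_eq_none] at h
    have := congrArg List.length h
    simp at this
    omega
  | some i =>
    exact ⟨i, rfl, fun j => List.le_of_mem_argmin (List.mem_finRange j) (Option.mem_def.2 h)⟩

lemma words_memoryOf {n d : ℕ} (c : Fin n → Fin d → ℝ) (p : Fin d → ℝ) (L : List (Fin d))
    (m : ℕ) (y : ℕ → ℝ) :
    (memoryOf c p L m y).words = L.length * Nat.clog 2 d + L.length + m * L.length + n * m := by
  simp [Memory.words, memoryOf, Function.comp_def]

/-! ### The first phase -/

lemma sum_getElem_sampled {T d : ℕ} (κ : Fin T → Fin d → Bool) (g : Fin d → ℝ) :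
    ∑ j : Fin (sampled κ).length, g (sampled κ)[j] =
      ∑ tb : Fin T × Fin d, if κ tb.1 tb.2 then g tb.2 else 0 := by
  have h1 : ∑ j : Fin (sampled κ).length, g (sampled κ)[j] = ((sampled κ).map g).sum := by
    rw [← List.sum_ofFn]
    congr 1
    apply List.ext_getElem <;> simp
  have h2 : ∀ (P : Fin d → Bool) (l : List (Fin d)),
      ((l.filter P).map g).sum = (l.map fun b => if P b then g b else 0).sum := by
    intro P l
    induction l with
    | nil => rfl
    | cons a l ih => by_cases h : P a <;> simp [h, ih]
  rw [h1, sampled, List.map_flatMap, List.flatMap_def, List.sum_flatten, List.map_map,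
    Fintype.sum_prod_type, ← List.ofFn_eq_map, List.sum_ofFn]
  refine Finset.sum_congr rfl fun t _ => ?_
  rw [Function.comp_apply, h2, ← List.ofFn_eq_map, List.sum_ofFn]

/-- Rewrites a sum over the random multiset `I` as a sum over the fixed grid of `T * d` independent
trials, to which the tail bounds apply. -/
lemma sum_getElem_sampled_choices {T d : ℕ} (p : Fin d → ℝ) (g : Fin d → ℝ)
    (x : ℕ → unitInterval) :
    ∑ j : Fin (sampled (choices T p x)).length, g (sampled (choices T p x))[j] =
      selectedSum (J := Fin T × Fin d) (fun tb => tb.1 * d + tb.2) (fun tb => p tb.2)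
        (fun tb => g tb.2) x := by
  rw [sum_getElem_sampled, selectedSum]
  refine Finset.sum_congr rfl fun tb _ => ?_
  simp [choices, Set.indicator_apply]

lemma injective_fin_mul_add (T d : ℕ) :
    Function.Injective fun tb : Fin T × Fin d => (tb.1 : ℕ) * d + tb.2 := by
  intro a b h
  have := injective_mul_add d (a₁ := ((a.1 : ℕ), a.2)) (a₂ := ((b.1 : ℕ), b.2)) h
  rw [Prod.mk.injEq] at this
  exact Prod.ext (Fin.ext this.1) this.2

lemma sum_fin_prod_snd (T d : ℕ) (g : Fin d → ℝ) :
    ∑ tb : Fin T × Fin d, g tb.2 = T * ∑ b, g b := by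
  rw [Fintype.sum_prod_type]; simp

lemma choices_measurable {d : ℕ} (T : ℕ) (p : Fin d → ℝ) : Measurable (choices T p) := by
  refine measurable_pi_lambda _ fun t => measurable_pi_lambda _ fun b => ?_
  refine measurable_to_bool ?_
  have : (fun x : ℕ → unitInterval => choices T p x t b) ⁻¹' {true} =
      {x | (x (t * d + b) : ℝ) < p b} := by
    ext x; simp [choices]
  rw [this]
  exact measurableSet_lt (measurable_subtype_coe.comp (measurable_pi_apply _)) measurable_const

/-- The law of the uniform random numbers. -/
noncomputable abbrev uniformLaw : Measure (ℕ → unitInterval) :=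
  Measure.infinitePi fun _ : ℕ => (volume : Measure unitInterval)

section firstPhase

variable {n d : ℕ} (c : Fin n → Fin d → ℝ) (T : ℕ)

/-- The upper tail of `|I|` is the lower tail of `-|I|`: with weights `-1` and `l = 1` the Chernoff
exponent is `-3Tn + 2T ∑ p ≤ -Tn`. -/
lemma measure_length_sampled :
    uniformLaw.real {x | 3 * T * (n : ℝ) < (sampled (choices T (coordProb c) x)).length} ≤
      Real.exp (-(T * n)) := by
  have h := measure_selectedSum_le (J := Fin T × Fin d) (a := fun _ => -1)
    (injective_fin_mul_add T d) (fun tb => coordProb_nonneg c tb.2)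
    (fun tb => coordProb_le_one c tb.2) zero_le_one (by simp) (-(3 * T * (n : ℝ)))
  refine (measureReal_mono fun x hx => ?_).trans (h.trans ?_)
  · have h1 := sum_getElem_sampled_choices (T := T) (coordProb c) (fun _ => -1) x
    simp only [Set.mem_ofPred_eq] at hx ⊢
    rw [← h1]
    simp
    linarith
  · rw [Real.exp_le_exp]
    have h2 := sum_fin_prod_snd T d fun b => coordProb c b * -1
    have h3 := sum_fin_prod_snd T d fun b => coordProb c b * (-1) ^ 2
    rw [h2, h3, ← Finset.sum_mul, ← Finset.sum_mul]
    have := mul_le_mul_of_nonneg_left (sum_coordProb_le c) (Nat.cast_nonneg (α := ℝ) T)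
    linarith

variable (q : Fin d → ℝ)

/-- The `ℓ₁` distance of the vectors `rᵢ` and `u`. -/
noncomputable def sampledDist (κ : Fin T → Fin d → Bool) (i : Fin n) : ℝ :=
  ∑ j : Fin (sampled κ).length,
    |c i (sampled κ)[j] - q (sampled κ)[j]| / coordProb c (sampled κ)[j]

/-- Markov's inequality. The mean is at most, and not always equal to, `T` times the distance,
because coordinates with `p = 0` are never sampled. Distance zero is treated apart, since Markov's
bound is divided by it. -/
lemma measure_sampledDist_le {δ : ℝ} (hδ : 0 < δ) (hT : 0 < T) (i : Fin n) :
    uniformLaw.real {x | ¬ sampledDist c T q (choices T (coordProb c) x) i ≤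
      4 * T * (∑ b, |c i b - q b|) / δ} ≤ δ / 4 := by
  have hT' : (0 : ℝ) < T := by exact_mod_cast hT
  rcases (Finset.sum_nonneg fun b _ => abs_nonneg (c i b - q b) :
    0 ≤ ∑ b, |c i b - q b|).eq_or_lt with h | h
  · have hz : ∀ b, |c i b - q b| = 0 := fun b =>
      (Finset.sum_eq_zero_iff_of_nonneg fun b _ => abs_nonneg (c i b - q b)).1 h.symm b
        (Finset.mem_univ b)
    simp only [sampledDist, hz]
    simp
    positivity
  · have hM := measure_le_selectedSum (J := Fin T × Fin d) (f := fun tb => tb.1 * d + tb.2)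
      (p := fun tb => coordProb c tb.2) (a := fun tb => |c i tb.2 - q tb.2| / coordProb c tb.2)
      (fun tb => coordProb_nonneg c tb.2) (fun tb => coordProb_le_one c tb.2)
      (fun tb => div_nonneg (abs_nonneg _) (coordProb_nonneg c _))
      (4 * T * (∑ b, |c i b - q b|) / δ)
    have h1 := sum_fin_prod_snd T d fun b => coordProb c b * (|c i b - q b| / coordProb c b)
    rw [h1] at hM
    have h2 : ∑ b, coordProb c b * (|c i b - q b| / coordProb c b) ≤ ∑ b, |c i b - q b| := by
      refine Finset.sum_le_sum fun b _ => ?_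
      rcases eq_or_ne (coordProb c b) 0 with h0 | h0
      · rw [h0, zero_mul]; exact abs_nonneg _
      · rw [mul_div_cancel₀ _ h0]
    refine (measureReal_mono (s₂ := {x | 4 * T * (∑ b, |c i b - q b|) / δ ≤
      selectedSum (J := Fin T × Fin d) (fun tb => tb.1 * d + tb.2) (fun tb => coordProb c tb.2)
        (fun tb => |c i tb.2 - q tb.2| / coordProb c tb.2) x}) fun x hx => ?_).trans ?_
    · rw [Set.mem_ofPred_eq, ← sum_getElem_sampled_choices (T := T) (coordProb c)
        (fun b => |c i b - q b| / coordProb c b)]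
      exact (not_le.1 hx).le
    · have h3 : T * ∑ b, coordProb c b * (|c i b - q b| / coordProb c b) ≤
          T * ∑ b, |c i b - q b| := by gcongr
      have hpos : 0 < 4 * T * (∑ b, |c i b - q b|) / δ := by positivity
      refine le_of_mul_le_mul_left ((hM.trans h3).trans (le_of_eq ?_)) hpos
      field_simp

lemma measure_sampledDist_lt {ε : ℝ} (hε : 0 < ε) (hε' : ε < 1) (i j : Fin n)
    (hij : (1 + ε) * (∑ b, |c j b - q b|) < ∑ b, |c i b - q b|) :
    uniformLaw.real {x | ¬ sampledDist c T q (choices T (coordProb c) x) j +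
        T * ((∑ b, |c i b - q b|) - ∑ b, |c j b - q b|) / 2 <
      sampledDist c T q (choices T (coordProb c) x) i} ≤ Real.exp (-(T * ε ^ 2 / 144)) := by
  set Ni := ∑ b, |c i b - q b| with hNi
  set Nj := ∑ b, |c j b - q b| with hNj
  set D := ∑ b, |c i b - c j b| with hD
  have hNj0 : 0 ≤ Nj := Finset.sum_nonneg fun b _ => abs_nonneg _
  set Δ := Ni - Nj with hΔ
  have hΔ0 : 0 < Δ := by nlinarith
  have hdiff : ∀ b, |(|c i b - q b| - |c j b - q b|)| ≤ |c i b - c j b| := fun b => by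
    simpa using abs_abs_sub_abs_le (c i b - q b) (c j b - q b)
  have hΔD : Δ ≤ D := by
    rw [hΔ, hNi, hNj, ← Finset.sum_sub_distrib]
    exact Finset.sum_le_sum fun b _ => (le_abs_self _).trans (hdiff b)
  have hDN : D ≤ Ni + Nj := by
    rw [hNi, hNj, ← Finset.sum_add_distrib]
    refine Finset.sum_le_sum fun b _ => ?_
    rw [abs_sub_comm (c j b)]
    exact abs_sub_le _ _ _
  have hD0 : 0 < D := hΔ0.trans_le hΔD
  -- `D ≤ Ni + Nj = Δ + 2 * Nj` and `ε * Nj < Δ`.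
  have hεD : ε * D ≤ 3 * Δ := by nlinarith
  set p := coordProb c with hp
  set a : Fin d → ℝ := fun b => (|c i b - q b| - |c j b - q b|) / p b with ha
  -- Where `p b = 0`, all points agree in coordinate `b`, so the difference of the two terms is zero
  -- and the mean of the sampled difference stays exact.
  have hpa : ∀ b, p b * a b = |c i b - q b| - |c j b - q b| := by
    intro b
    rcases eq_or_ne (p b) 0 with h0 | h0
    · have h1 := abs_sub_le_coordProb_mul c i j b
      rw [← hp, h0, zero_mul] at h1
      rw [h0, zero_mul, eq_comm, ← abs_eq_zero]
      exact le_antisymm ((hdiff b).trans h1) (abs_nonneg _)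
    · exact mul_div_cancel₀ _ h0
  have haD : ∀ b, |a b| ≤ D := by
    intro b
    rw [ha, abs_div, abs_of_nonneg (coordProb_nonneg c b)]
    refine div_le_of_le_mul₀ (coordProb_nonneg c b) hD0.le ?_
    rw [mul_comm]
    exact (hdiff b).trans (abs_sub_le_coordProb_mul c i j b)
  -- One factor `a b` is bounded by `D`; the remaining `|p b * a b|` is at most `|c i b - c j b|`,
  -- and these add up to `D`.
  have hV : ∑ b, p b * a b ^ 2 ≤ D ^ 2 := by
    rw [sq D]
    nth_rewrite 1 [hD]
    rw [Finset.sum_mul]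
    refine Finset.sum_le_sum fun b _ => ?_
    rw [sq, ← mul_assoc, hpa]
    refine (le_abs_self _).trans ?_
    rw [abs_mul]
    exact mul_le_mul (hdiff b) (haD b) (abs_nonneg _) (abs_nonneg _)
  have hμ : ∑ b, p b * a b = Δ := by
    simp_rw [hpa]
    rw [Finset.sum_sub_distrib]
  -- This `l` minimizes `-l * T * Δ / 2 + l ^ 2 * T * D ^ 2`; the minimum is `-T * (Δ / D) ^ 2 /
  -- 16`.
  have hl : 0 ≤ Δ / (4 * D ^ 2) := by positivity
  have h := measure_selectedSum_le (J := Fin T × Fin d) (a := fun tb => a tb.2)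
    (injective_fin_mul_add T d) (fun tb => coordProb_nonneg c tb.2)
    (fun tb => coordProb_le_one c tb.2) hl (fun tb => by
      rw [abs_mul, abs_of_nonneg hl]
      calc Δ / (4 * D ^ 2) * |a tb.2| ≤ D / (4 * D ^ 2) * D := by
            gcongr
            exact haD _
        _ ≤ 1 := by field_simp; norm_num) (T * Δ / 2)
  refine (measureReal_mono fun x hx => ?_).trans (h.trans ?_)
  · rw [Set.mem_ofPred_eq, ← sum_getElem_sampled_choices (T := T) p a]
    rw [Set.mem_ofPred_eq, not_lt, sampledDist, sampledDist] at hx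
    simp only [ha, sub_div, Finset.sum_sub_distrib]
    linarith
  · rw [Real.exp_le_exp, sum_fin_prod_snd T d fun b => coordProb c b * a b,
      sum_fin_prod_snd T d fun b => coordProb c b * a b ^ 2, ← hp, hμ]
    have h1 : (Δ / (4 * D ^ 2)) ^ 2 * (T * ∑ b, p b * a b ^ 2) ≤
        (Δ / (4 * D ^ 2)) ^ 2 * (T * D ^ 2) := by gcongr
    have h2 : (Δ / (4 * D ^ 2)) * (T * Δ / 2) - (Δ / (4 * D ^ 2)) * (T * Δ) +
        (Δ / (4 * D ^ 2)) ^ 2 * (T * D ^ 2) = -(T * (Δ / D) ^ 2 / 16) := by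
      field_simp; ring
    have h3 : ε / 3 ≤ Δ / D := by rw [div_le_div_iff₀ three_pos hD0]; linarith
    have h4 : T * (ε / 3) ^ 2 / 16 ≤ T * (Δ / D) ^ 2 / 16 := by gcongr
    have h5 : T * (ε / 3) ^ 2 / 16 = T * ε ^ 2 / 144 := by ring
    linarith

end firstPhase

/-! ### Both phases -/

/-- The law of the Cauchy random numbers. -/
noncomputable abbrev cauchyLaw : Measure (ℕ → ℝ) :=
  Measure.infinitePi fun _ : ℕ => ProbabilityTheory.cauchyMeasure 0 1

/-- Conditioning on a finite-valued `κ`: the product space is cut into rectangles, so neither Fubini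
nor measurability of the sets `F k` is needed. -/
lemma measure_prod_le_of_finite {X Y K : Type*} [MeasurableSpace X] [MeasurableSpace Y] [Fintype K]
    [MeasurableSpace K] [MeasurableSingletonClass K] (μ : Measure X) (ν : Measure Y)
    [IsProbabilityMeasure μ] [IsProbabilityMeasure ν] {κ : X → K} (hκ : Measurable κ)
    (F : K → Set Y) {η : ℝ} (h : ∀ k, ν.real (F k) ≤ η) :
    (μ.prod ν).real {z | z.2 ∈ F (κ z.1)} ≤ η := by
  have hsub : {z : X × Y | z.2 ∈ F (κ z.1)} ⊆ ⋃ k, (κ ⁻¹' {k}) ×ˢ F k := by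
    intro z hz
    exact Set.mem_iUnion.2 ⟨κ z.1, rfl, hz⟩
  calc (μ.prod ν).real {z | z.2 ∈ F (κ z.1)}
      ≤ (μ.prod ν).real (⋃ k, (κ ⁻¹' {k}) ×ˢ F k) := measureReal_mono hsub
    _ ≤ ∑ k, (μ.prod ν).real ((κ ⁻¹' {k}) ×ˢ F k) := measureReal_iUnion_fintype_le _
    _ = ∑ k, μ.real (κ ⁻¹' {k}) * ν.real (F k) := by
        simp only [Measure.real, Measure.prod_prod, ENNReal.toReal_mul]
    _ ≤ ∑ k, μ.real (κ ⁻¹' {k}) * η := by gcongr with k _; exact h k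
    _ = η := by
        rw [← Finset.sum_mul, sum_measureReal_preimage_singleton _
          fun k _ => hκ (measurableSet_singleton k)]
        simp

lemma measure_prod_fst {X Y : Type*} [MeasurableSpace X] [MeasurableSpace Y] (μ : Measure X)
    (ν : Measure Y) [IsProbabilityMeasure μ] [IsProbabilityMeasure ν] (E : Set X) :
    (μ.prod ν).real {z | z.1 ∈ E} = μ.real E := by
  have : {z : X × Y | z.1 ∈ E} = E ×ˢ Set.univ := by ext; simp
  rw [this, Measure.real, Measure.prod_prod, measure_univ, mul_one]; rfl

lemma measure_estimate_le {n d T m : ℕ} (hm : 0 < m) (c : Fin n → Fin d → ℝ) (q : Fin d → ℝ)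
    (κ : Fin T → Fin d → Bool) {η : ℝ} (h0 : 0 ≤ η) (h1 : η ≤ 1) :
    cauchyLaw.real {y | ∃ i, ¬ ((1 - η) * sampledDist c T q κ i ≤
          estimate c (coordProb c) q (sampled κ) m y i ∧
        estimate c (coordProb c) q (sampled κ) m y i ≤ (1 + η) * sampledDist c T q κ i)} ≤
      n * (2 * Real.exp (-(2 * (η / 10) ^ 2 * m))) := by
  have hR : ∀ i, sampledDist c T q κ i = ∑ j : Fin (sampled κ).length,
      |(c i (sampled κ)[j] - q (sampled κ)[j]) / coordProb c (sampled κ)[j]| := by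
    intro i
    refine Finset.sum_congr rfl fun j _ => ?_
    rw [abs_div, abs_of_nonneg (coordProb_nonneg c _)]
  simp_rw [hR]
  rw [Set.ofPred_exists]
  refine (measureReal_iUnion_fintype_le _).trans ?_
  refine (Finset.sum_le_sum fun i _ => measure_sketch_le hm _ _ h0 h1).trans ?_
  simp

/-- The events under which a run of the data structure succeeds. -/
structure Good {n d : ℕ} (c : Fin n → Fin d → ℝ) (T m : ℕ) (q : Fin d → ℝ) (ε δ : ℝ) (j : Fin n)
    (ω : Tape) : Prop where
  length : ((sampled (choices T (coordProb c) ω.1)).length : ℝ) ≤ 3 * T * n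
  nearest : sampledDist c T q (choices T (coordProb c) ω.1) j ≤ 4 * T * (∑ b, |c j b - q b|) / δ
  separated : ∀ i, (1 + ε) * (∑ b, |c j b - q b|) < ∑ b, |c i b - q b| →
    sampledDist c T q (choices T (coordProb c) ω.1) j +
        T * ((∑ b, |c i b - q b|) - ∑ b, |c j b - q b|) / 2 <
      sampledDist c T q (choices T (coordProb c) ω.1) i
  sketched : ∀ i, (1 - ε * δ / 32) * sampledDist c T q (choices T (coordProb c) ω.1) i ≤
      estimate c (coordProb c) q (sampled (choices T (coordProb c) ω.1)) m ω.2 i ∧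
    estimate c (coordProb c) q (sampled (choices T (coordProb c) ω.1)) m ω.2 i ≤
      (1 + ε * δ / 32) * sampledDist c T q (choices T (coordProb c) ω.1) i

instance : IsProbabilityMeasure tapeLaw := by unfold tapeLaw; infer_instance

section good

variable {n d T m : ℕ} (c : Fin n → Fin d → ℝ) (q : Fin d → ℝ) {ε δ : ℝ} (j : Fin n)

lemma measure_not_good (hε : 0 < ε) (hε' : ε < 1 / 4) (hδ : 0 < δ) (hδ' : δ < 1) (hT : 0 < T) (hm : 0 < m) :
    tapeLaw.real {ω | ¬ Good c T m q ε δ j ω} ≤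
      Real.exp (-(T * n)) + δ / 4 + n * Real.exp (-(T * ε ^ 2 / 144)) +
        n * (2 * Real.exp (-(2 * (ε * δ / 32 / 10) ^ 2 * m))) := by
  set E₁ := {x : ℕ → unitInterval |
    3 * T * (n : ℝ) < (sampled (choices T (coordProb c) x)).length} with hE₁
  set E₂ := {x : ℕ → unitInterval | ¬ sampledDist c T q (choices T (coordProb c) x) j ≤
      4 * T * (∑ b, |c j b - q b|) / δ} with hE₂
  set E₃ := {x : ℕ → unitInterval | ∃ i, (1 + ε) * (∑ b, |c j b - q b|) < ∑ b, |c i b - q b| ∧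
    ¬ sampledDist c T q (choices T (coordProb c) x) j +
        T * ((∑ b, |c i b - q b|) - ∑ b, |c j b - q b|) / 2 <
      sampledDist c T q (choices T (coordProb c) x) i} with hE₃
  set F : (Fin T → Fin d → Bool) → Set (ℕ → ℝ) := fun κ =>
    {y | ∃ i, ¬ ((1 - ε * δ / 32) * sampledDist c T q κ i ≤
          estimate c (coordProb c) q (sampled κ) m y i ∧
        estimate c (coordProb c) q (sampled κ) m y i ≤
          (1 + ε * δ / 32) * sampledDist c T q κ i)} with hF
  have h3 : uniformLaw.real E₃ ≤ n * Real.exp (-(T * ε ^ 2 / 144)) := by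
    rw [hE₃, Set.ofPred_exists]
    refine (measureReal_iUnion_fintype_le _).trans ?_
    refine (Finset.sum_le_sum (g := fun _ => Real.exp (-(T * ε ^ 2 / 144))) fun i _ => ?_).trans
      (by simp)
    by_cases hi : (1 + ε) * (∑ b, |c j b - q b|) < ∑ b, |c i b - q b|
    · simp only [hi, true_and]
      exact measure_sampledDist_lt c T q hε (by linarith) i j hi
    · simp only [hi, false_and]
      simpa using (Real.exp_pos _).le
  have hsub : {ω : Tape | ¬ Good c T m q ε δ j ω} ⊆
      (({ω | ω.1 ∈ E₁} ∪ {ω | ω.1 ∈ E₂}) ∪ {ω | ω.1 ∈ E₃}) ∪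
        {ω | ω.2 ∈ F (choices T (coordProb c) ω.1)} := by
    intro ω hω
    by_contra hcon
    simp only [Set.mem_union, not_or] at hcon
    obtain ⟨⟨⟨h1, h2⟩, h3⟩, h4⟩ := hcon
    refine hω ⟨not_lt.1 h1, not_not.1 h2, fun i hi => ?_, fun i => ?_⟩
    · by_contra h
      exact h3 ⟨i, hi, h⟩
    · by_contra h
      exact h4 ⟨i, h⟩
  have hη0 : 0 ≤ ε * δ / 32 := by positivity
  have hη1 : ε * δ / 32 ≤ 1 := by nlinarith
  refine (measureReal_mono hsub).trans ?_
  refine (measureReal_union_le _ _).trans (add_le_add ((measureReal_union_le _ _).trans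
    (add_le_add ((measureReal_union_le _ _).trans (add_le_add ?_ ?_)) ?_)) ?_)
  · exact (measure_prod_fst _ _ _).trans_le (measure_length_sampled c T)
  · exact (measure_prod_fst _ _ _).trans_le (measure_sampledDist_le c T q hδ hT j)
  · exact (measure_prod_fst _ _ _).trans_le h3
  · exact measure_prod_le_of_finite _ _ (choices_measurable T _) F
      fun κ => measure_estimate_le hm c q κ hη0 hη1

/-- If `i` were too far, minimality of its estimate and the sketch bounds with `η = ε * δ / 32`
would give `(1 - η) T Δ / 2 ≤ 2 η Rj`, where `Δ = Ni - Nj`. But `2 η Rj ≤ T ε Nj / 4 < T Δ / 4`, a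
contradiction. -/
lemma Good.approx {ω : Tape} (h : Good c T m q ε δ j ω) (hε : 0 < ε) (hε' : ε < 1 / 4)
    (hδ : 0 < δ) (hδ' : δ < 1) (hT : 0 < T) {i : Fin n}
    (hi : estimate c (coordProb c) q (sampled (choices T (coordProb c) ω.1)) m ω.2 i ≤
      estimate c (coordProb c) q (sampled (choices T (coordProb c) ω.1)) m ω.2 j) :
    ∑ b, |c i b - q b| ≤ (1 + ε) * ∑ b, |c j b - q b| := by
  by_contra hcon
  rw [not_le] at hcon
  have hT' : (0 : ℝ) < T := by exact_mod_cast hT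
  have h1 := h.separated i hcon
  have h2 := (h.sketched i).1
  have h3 := (h.sketched j).2
  have h4 := h.nearest
  set Ri := sampledDist c T q (choices T (coordProb c) ω.1) i
  set Rj := sampledDist c T q (choices T (coordProb c) ω.1) j
  set Ni := ∑ b, |c i b - q b|
  set Nj := ∑ b, |c j b - q b|
  have hη0 : 0 < ε * δ := by positivity
  have hη1 : ε * δ < 1 / 4 := by nlinarith
  -- The factor `δ` in the sketch accuracy cancels the `1 / δ` lost in Markov's inequality.
  have h5 : ε * δ * Rj ≤ 4 * T * (ε * Nj) := by
    calc ε * δ * Rj ≤ ε * δ * (4 * T * Nj / δ) := by gcongr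
      _ = 4 * T * (ε * Nj) := by field_simp
  have h6 : T * (ε * Nj) < T * (Ni - Nj) := by gcongr; linarith
  have hΔ : 0 < T * (Ni - Nj) := lt_of_le_of_lt (mul_nonneg hT'.le (mul_nonneg hε.le
    (Finset.sum_nonneg fun b _ => abs_nonneg _))) h6
  have h7 : (1 - ε * δ / 32) * (Rj + T * (Ni - Nj) / 2) ≤ (1 - ε * δ / 32) * Ri := by
    gcongr
    linarith
  nlinarith

end good

/-! ### Parameters -/

section parameters

variable {n d : ℕ} {ε δ : ℝ}

lemma half_lt_log_div (hn : 2 ≤ n) (hδ : 0 < δ) (hδ' : δ < 1) : 1 / 2 < Real.log (n / δ) := by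
  have h2 : (2 : ℝ) ≤ n := by exact_mod_cast hn
  have h : (2 : ℝ) ≤ n / δ := by rw [le_div_iff₀ hδ]; nlinarith
  linarith [Real.log_two_gt_d9, Real.log_le_log two_pos h]

lemma log_div_le (hn : 2 ≤ n) (hδ : 0 < δ) : Real.log (n / δ) ≤ n / δ := by
  have h2 : (2 : ℝ) ≤ n := by exact_mod_cast hn
  have : (0 : ℝ) < n / δ := by positivity
  linarith [Real.log_le_sub_one_of_pos this]

/-- Lets the rounding up in `T` and `m`, and other additive constants, be absorbed into the constant
factor. -/
lemma one_le_log_div_pow (hn : 2 ≤ n) (hε : 0 < ε) (hε' : ε < 1 / 4) (hδ : 0 < δ) (hδ' : δ < 1)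
    {r : ℕ} (hr : 2 ≤ r) : 1 ≤ Real.log (n / δ) / (ε ^ r * δ ^ 2) := by
  rw [one_le_div (by positivity)]
  have h1 : ε ^ r ≤ ε ^ 2 := pow_le_pow_of_le_one hε.le (by linarith) hr
  have h2 : ε ^ 2 ≤ (1 / 4) ^ 2 := by gcongr
  have h3 : δ ^ 2 ≤ 1 := pow_le_one₀ hδ.le hδ'.le
  have h4 : ε ^ r * δ ^ 2 ≤ (1 / 4) ^ 2 * 1 := mul_le_mul (h1.trans h2) h3 (by positivity) (by positivity)
  linarith [half_lt_log_div hn hδ hδ']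

lemma ceil_parameter_le (C : ℕ) (hn : 2 ≤ n) (hε : 0 < ε) (hε' : ε < 1 / 4) (hδ : 0 < δ)
    (hδ' : δ < 1) {r : ℕ} (hr : 2 ≤ r) :
    (⌈C * Real.log (n / δ) / (ε ^ r * δ ^ 2)⌉₊ : ℝ) ≤
      (C + 1) * (Real.log (n / δ) / (ε ^ r * δ ^ 2)) := by
  have h1 := one_le_log_div_pow hn hε hε' hδ hδ' hr
  have h2 : 0 ≤ C * Real.log (n / δ) / (ε ^ r * δ ^ 2) := by
    rw [mul_div_assoc]; positivity
  have h3 := (Nat.ceil_lt_add_one h2).le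
  rw [mul_div_assoc] at h3 ⊢
  linarith

lemma log_div_pow_le (hn : 2 ≤ n) (hd : 2 ≤ d) (hε : 0 < ε) (hε' : ε < 1 / 4) (hδ : 0 < δ)
    {r : ℕ} (hr : r ≤ 3) :
    Real.log (n / δ) / (ε ^ r * δ ^ 2) ≤ ((n : ℝ) * d / (ε * δ)) ^ 3 := by
  have h2 : (1 : ℝ) ≤ n := by exact_mod_cast (by omega : 1 ≤ n)
  have h3 : (1 : ℝ) ≤ d := by exact_mod_cast (by omega : 1 ≤ d)
  have h4 : ε ^ 3 ≤ ε ^ r := pow_le_pow_of_le_one hε.le (by linarith) hr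
  calc Real.log (n / δ) / (ε ^ r * δ ^ 2) ≤ (n / δ) / (ε ^ 3 * δ ^ 2) := by
        have := log_div_le hn hδ
        gcongr
    _ = n / (ε * δ) ^ 3 := by field_simp
    _ ≤ (n * d) ^ 3 / (ε * δ) ^ 3 := by
        gcongr
        calc (n : ℝ) ≤ n * d := le_mul_of_one_le_right (by linarith) h3
          _ ≤ (n * d) ^ 3 := le_self_pow₀ (one_le_mul_of_one_le_of_one_le h2 h3) (by norm_num)
    _ = _ := by rw [div_pow]

/-- The number of steps of the preprocessing is polynomial. -/
lemma steps_le {T m N : ℕ} {a b X : ℝ} (ha : 1 ≤ a) (hb : 1 ≤ b) (hX : 1 ≤ X) (hn : (n : ℝ) ≤ X)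
    (hd : (d : ℝ) ≤ X) (hT : (T : ℝ) ≤ a * X ^ 3) (hm : (m : ℝ) ≤ b * X ^ 3) (hN : N ≤ T * d) :
    ((T + 13 + (m + 13 + (d * (n ^ 2 * (3 * d + 5) + 1) + (T * (d * 2) + (m * N +
        n * (N + m * (2 * N + 1)))))) : ℕ) : ℝ) ≤ 50 * (a * b) * X ^ 8 := by
  have hX0 : 0 ≤ X := by linarith
  have hab : 1 ≤ a * b := one_le_mul_of_one_le_of_one_le ha hb
  have haab : a ≤ a * b := le_mul_of_one_le_right (by linarith) hb
  have hbab : b ≤ a * b := le_mul_of_one_le_left (by linarith) ha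
  have key : ∀ {s : ℝ} {k : ℕ}, s ≤ a * b → k ≤ 8 → s * X ^ k ≤ a * b * X ^ 8 := by
    intro s k hs hk
    exact mul_le_mul hs (pow_le_pow_right₀ hX hk) (by positivity) (by linarith)
  have hN' : (N : ℝ) ≤ a * X ^ 4 := by
    calc (N : ℝ) ≤ T * d := by exact_mod_cast hN
      _ ≤ (a * X ^ 3) * X := by gcongr
      _ = a * X ^ 4 := by ring
  have t1 : (T : ℝ) ≤ a * b * X ^ 8 := hT.trans (key haab (by norm_num))
  have t2 : (m : ℝ) ≤ a * b * X ^ 8 := hm.trans (key hbab (by norm_num))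
  have t3 : (1 : ℝ) ≤ a * b * X ^ 8 := by simpa using key (k := 0) hab (by norm_num)
  have t4 : (d : ℝ) * n ^ 2 * d ≤ a * b * X ^ 8 := by
    calc (d : ℝ) * n ^ 2 * d ≤ X * X ^ 2 * X := by gcongr
      _ = 1 * X ^ 4 := by ring
      _ ≤ _ := key hab (by norm_num)
  have t5 : (d : ℝ) * n ^ 2 ≤ a * b * X ^ 8 := by
    calc (d : ℝ) * n ^ 2 ≤ X * X ^ 2 := by gcongr
      _ = 1 * X ^ 3 := by ring
      _ ≤ _ := key hab (by norm_num)
  have t6 : (d : ℝ) ≤ a * b * X ^ 8 := by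
    calc (d : ℝ) ≤ 1 * X ^ 1 := by simpa using hd
      _ ≤ _ := key hab (by norm_num)
  have t7 : (T : ℝ) * d ≤ a * b * X ^ 8 := by
    calc (T : ℝ) * d ≤ (a * X ^ 3) * X := by gcongr
      _ = a * X ^ 4 := by ring
      _ ≤ _ := key haab (by norm_num)
  have t8 : (m : ℝ) * N ≤ a * b * X ^ 8 := by
    calc (m : ℝ) * N ≤ (b * X ^ 3) * (a * X ^ 4) := by gcongr
      _ = a * b * X ^ 7 := by ring
      _ ≤ _ := key le_rfl (by norm_num)
  have t9 : (n : ℝ) * N ≤ a * b * X ^ 8 := by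
    calc (n : ℝ) * N ≤ X * (a * X ^ 4) := by gcongr
      _ = a * X ^ 5 := by ring
      _ ≤ _ := key haab (by norm_num)
  -- The dominant term, computing the sketches, with degree `1 + 3 + 4 = 8`.
  have t10 : (n : ℝ) * (m * N) ≤ a * b * X ^ 8 := by
    calc (n : ℝ) * (m * N) ≤ X * ((b * X ^ 3) * (a * X ^ 4)) := by gcongr
      _ = a * b * X ^ 8 := by ring
  have t11 : (n : ℝ) * m ≤ a * b * X ^ 8 := by
    calc (n : ℝ) * m ≤ X * (b * X ^ 3) := by gcongr
      _ = b * X ^ 4 := by ring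
      _ ≤ _ := key hbab (by norm_num)
  push_cast
  linarith

/-- The size of the data structure in terms of the numbers of sampled coordinates and of rows. -/
lemma words_le {N m : ℕ} {a b Q P : ℝ} (ha : 1 ≤ a) (hb : 1 ≤ b) (hQ : 1 ≤ Q) (hP : 1 ≤ P)
    (hd : 2 ≤ d) (hN : (N : ℝ) ≤ 3 * n * (a * Q)) (hm : (m : ℝ) ≤ b * P) :
    ((N * Nat.clog 2 d + N + m * N + n * m : ℕ) : ℝ) ≤
      50 * (a * b) * (n * Q * P * Real.log d) := by
  have h2 : Real.log 2 ≤ Real.log d := Real.log_le_log two_pos (by exact_mod_cast hd)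
  have hl : 1 / 2 ≤ Real.log d := by linarith [Real.log_two_gt_d9]
  -- `2 ^ (clog - 1) < d`; as `d ≥ 2`, the rounding up is absorbed by `Real.log d`.
  have hclog : (Nat.clog 2 d : ℝ) ≤ 4 * Real.log d := by
    have h1 : 2 ^ (Nat.clog 2 d - 1) < d := Nat.pow_pred_clog_lt_self (by norm_num) (by omega)
    have h3 : ((Nat.clog 2 d - 1 : ℕ) : ℝ) * Real.log 2 ≤ Real.log d := by
      rw [← Real.log_pow]
      exact Real.log_le_log (by positivity) (by exact_mod_cast h1.le)
    have h4 : (Nat.clog 2 d : ℝ) ≤ ((Nat.clog 2 d - 1 : ℕ) : ℝ) + 1 := by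
      exact_mod_cast (by omega : Nat.clog 2 d ≤ Nat.clog 2 d - 1 + 1)
    have h5 : (0 : ℝ) ≤ ((Nat.clog 2 d - 1 : ℕ) : ℝ) := Nat.cast_nonneg _
    nlinarith [Real.log_two_gt_d9]
  set W := (n : ℝ) * Q * P * Real.log d with hW
  have hn : (0 : ℝ) ≤ n := Nat.cast_nonneg n
  have hab : a ≤ a * b := le_mul_of_one_le_right (by linarith) hb
  have hba : b ≤ a * b := le_mul_of_one_le_left (by linarith) ha
  have hNm : (m : ℝ) * N ≤ 6 * (a * b) * W := by
    calc (m : ℝ) * N ≤ (b * P) * (3 * n * (a * Q)) := by gcongr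
      _ = 6 * (a * b) * (n * Q * P * (1 / 2)) := by ring
      _ ≤ 6 * (a * b) * W := by rw [hW]; gcongr
  have hN1 : (N : ℝ) ≤ 6 * (a * b) * W := by
    calc (N : ℝ) ≤ 3 * n * (a * Q) := hN
      _ = 6 * a * (n * Q * 1 * (1 / 2)) := by ring
      _ ≤ 6 * (a * b) * W := by rw [hW]; gcongr
  have hNc : (N : ℝ) * Nat.clog 2 d ≤ 12 * (a * b) * W := by
    calc (N : ℝ) * Nat.clog 2 d ≤ (3 * n * (a * Q)) * (4 * Real.log d) := by gcongr
      _ = 12 * a * (n * Q * 1 * Real.log d) := by ring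
      _ ≤ 12 * (a * b) * W := by rw [hW]; gcongr
  have hnm : (n : ℝ) * m ≤ 2 * (a * b) * W := by
    calc (n : ℝ) * m ≤ n * (b * P) := by gcongr
      _ = 2 * b * (n * 1 * P * (1 / 2)) := by ring
      _ ≤ 2 * (a * b) * W := by rw [hW]; gcongr
  have hpos : 0 ≤ a * b * W := by positivity
  push_cast
  linarith

/-- The constants make each exponent at least `4 * log (n / δ)`, so each exponential is at most `(δ
/ n) ^ 4`. With multiplicities `1`, `n` and `2 n` they contribute at most `δ / 2`, next to Markov's
`δ / 4`. -/
lemma failure_le {T m : ℕ} (hn : 2 ≤ n) (hε : 0 < ε) (hε' : ε < 1 / 4) (hδ : 0 < δ) (hδ' : δ < 1)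
    (hT : 576 * Real.log (n / δ) / (ε ^ 3 * δ ^ 2) ≤ T)
    (hm : 204800 * Real.log (n / δ) / (ε ^ 2 * δ ^ 2) ≤ m) :
    Real.exp (-(T * n)) + δ / 4 + n * Real.exp (-(T * ε ^ 2 / 144)) +
        n * (2 * Real.exp (-(2 * (ε * δ / 32 / 10) ^ 2 * m))) ≤ δ := by
  set L := Real.log (n / δ) with hL
  have hL0 : 0 < L := by linarith [half_lt_log_div hn hδ hδ']
  have h2 : (2 : ℝ) ≤ n := by exact_mod_cast hn
  have hd2 : δ ^ 2 ≤ 1 := pow_le_one₀ hδ.le hδ'.le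
  have he1 : ε ≤ 1 := by linarith
  have hTε : 576 * L ≤ T * ε ^ 2 := by
    have h1 : 576 * L / (ε ^ 2 * 1) ≤ 576 * L / (ε ^ 3 * δ ^ 2) := by
      have : ε ^ 3 * δ ^ 2 ≤ ε ^ 2 * 1 := mul_le_mul
        (pow_le_pow_of_le_one hε.le he1 (by norm_num)) hd2 (by positivity) (by positivity)
      gcongr
    have h3 := h1.trans hT
    rwa [mul_one, div_le_iff₀ (by positivity)] at h3
  have hT4 : 4 * L ≤ T * n := by
    have h1 : T * ε ^ 2 ≤ T * 1 := by
      gcongr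
      exact pow_le_one₀ hε.le he1
    have h3 : (T : ℝ) * 1 ≤ T * n := by gcongr; linarith
    linarith
  have hm4 : 4 * L ≤ 2 * (ε * δ / 32 / 10) ^ 2 * m := by
    rw [div_le_iff₀ (by positivity)] at hm
    have : 2 * (ε * δ / 32 / 10) ^ 2 * m = (m * (ε ^ 2 * δ ^ 2)) / 51200 := by ring
    rw [this, le_div_iff₀ (by norm_num)]
    linarith
  have hnδ : (0 : ℝ) < n / δ := by positivity
  have hexp : Real.exp (-(4 * L)) = (δ / n) ^ 4 := by
    rw [Real.exp_neg, show 4 * L = (4 : ℕ) * L by norm_num, Real.exp_nat_mul, hL, Real.exp_log hnδ,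
      ← inv_pow, inv_div]
  have e1 : Real.exp (-(T * n)) ≤ (δ / n) ^ 4 := by
    rw [← hexp]; exact Real.exp_le_exp.2 (by linarith)
  have e2 : Real.exp (-(T * ε ^ 2 / 144)) ≤ (δ / n) ^ 4 := by
    rw [← hexp]; exact Real.exp_le_exp.2 (by linarith)
  have e3 : Real.exp (-(2 * (ε * δ / 32 / 10) ^ 2 * m)) ≤ (δ / n) ^ 4 := by
    rw [← hexp]; exact Real.exp_le_exp.2 (by linarith)
  have hn8 : n * (δ / n) ^ 4 ≤ δ / 8 := by
    have h1 : n * (δ / n) ^ 4 = δ * (δ / n) ^ 3 := by field_simp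
    have h3 : δ / n ≤ 1 / 2 := by rw [div_le_div_iff₀ (by linarith) two_pos]; linarith
    have h4 : (δ / n) ^ 3 ≤ (1 / 2) ^ 3 := by gcongr
    rw [h1]
    nlinarith
  have f2 : n * Real.exp (-(T * ε ^ 2 / 144)) ≤ n * (δ / n) ^ 4 := by gcongr
  have f3 : n * (2 * Real.exp (-(2 * (ε * δ / 32 / 10) ^ 2 * m))) ≤ n * (2 * (δ / n) ^ 4) := by gcongr
  have f1 : (δ / n) ^ 4 ≤ n * (δ / n) ^ 4 := le_mul_of_one_le_left (by positivity) (by linarith)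
  linarith

end parameters

/-! ### Assembly of the main theorem -/

lemma execute_eq {n d : ℕ} (A B : ℕ) (c : Fin n → L1Space d) (ε δ : ℝ) (ω : Tape) {T m : ℕ}
    (hT : T = ⌈A * Real.log (n / δ) / (ε ^ 3 * δ ^ 2)⌉₊)
    (hm : m = ⌈B * Real.log (n / δ) / (ε ^ 2 * δ ^ 2)⌉₊) :
    let p := coordProb fun i b => c i b
    let L := sampled (choices T p ω.1)
    build A B c ε δ ω = memoryOf (fun i b => c i b) p L m ω.2 ∧
      buildSteps A B c ε δ ω ≤ T + 13 + (m + 13 + (d * (n ^ 2 * (3 * d + 5) + 1) +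
        (T * (d * 2) + (m * L.length + n * (L.length + m * (2 * L.length + 1)))))) := by
  intro p L
  obtain ⟨t, ht, h⟩ := preprocess_eval A B (fun i b => c i b) ε δ ω hT hm rfl 0
  unfold build buildSteps execute
  rw [h]
  exact ⟨rfl, by simpa using ht⟩

lemma dist_eq_sum_abs {d : ℕ} (x y : L1Space d) : dist x y = ∑ b, |y b - x b| := by
  rw [PiLp.dist_eq_of_L1]
  exact Finset.sum_congr rfl fun b _ => by rw [Real.dist_eq, abs_sub_comm]

end L1NN

theorem mainTheorem1 :
    ∃ A B K k : ℕ, ∀ (n d : ℕ) (c : Fin n → L1NN.L1Space d) (ε δ : ℝ),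
      2 ≤ n → 2 ≤ d → Function.Injective c → 0 < ε → ε < 1 / 4 → 0 < δ → δ < 1 →
      (∀ ω : L1NN.Tape,
        (L1NN.buildSteps A B c ε δ ω : ℝ) ≤ K * ((n : ℝ) * d / (ε * δ)) ^ k) ∧
      ∀ q : L1NN.L1Space d,
        L1NN.tapeLaw {ω | ¬
          (((L1NN.build A B c ε δ ω).reads : ℝ)
              ≤ K * (n * Real.log (n / δ) / (ε ^ 3 * δ ^ 2)) ∧
            (∃ i : Fin n, L1NN.query (L1NN.build A B c ε δ ω) (fun b => q b) = some i ∧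
              L1NN.IsApproxNearest (1 + ε) c q i) ∧
            ((L1NN.build A B c ε δ ω).words : ℝ)
              ≤ K * (n * Real.log (n / δ) ^ 2 * Real.log d / (ε ^ 5 * δ ^ 4)))}
          ≤ ENNReal.ofReal δ := by
  open L1NN in
  -- `576 = 4 * 144` and `204800 = 4 * 51200` match the exponents `T ε² / 144` and `m ε² δ² / 51200`
  -- of the tail bounds. `K` is the common constant of `steps_le` and `words_le`, and `8` is the
  -- degree in `steps_le`.
  refine ⟨576, 204800, 50 * ((576 + 1) * (204800 + 1)), 8, ?_⟩
  intro n d c ε δ hn hd _ hε hε' hδ hδ'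
  set T := ⌈((576 : ℕ) : ℝ) * Real.log (n / δ) / (ε ^ 3 * δ ^ 2)⌉₊ with hT
  set m := ⌈((204800 : ℕ) : ℝ) * Real.log (n / δ) / (ε ^ 2 * δ ^ 2)⌉₊ with hm
  have hQ := one_le_log_div_pow hn hε hε' hδ hδ' (r := 3) (by norm_num)
  have hP := one_le_log_div_pow hn hε hε' hδ hδ' (r := 2) le_rfl
  have hTle := ceil_parameter_le 576 hn hε hε' hδ hδ' (r := 3) (by norm_num)
  have hmle := ceil_parameter_le 204800 hn hε hε' hδ hδ' (r := 2) le_rfl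
  rw [← hT] at hTle
  rw [← hm] at hmle
  have hn1 : (1 : ℝ) ≤ n := by exact_mod_cast (by omega : 1 ≤ n)
  have hd1 : (1 : ℝ) ≤ d := by exact_mod_cast (by omega : 1 ≤ d)
  set c' : Fin n → Fin d → ℝ := fun i b => c i b with hc'
  constructor
  · intro ω
    have hstep := (execute_eq 576 204800 c ε δ ω hT hm).2
    have hεδ : ε * δ ≤ 1 := by nlinarith
    have hX : (n : ℝ) * d ≤ n * d / (ε * δ) := le_div_self (by positivity) (by positivity) hεδ
    have hnd : (1 : ℝ) ≤ n * d := one_le_mul_of_one_le_of_one_le hn1 hd1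
    have := steps_le (n := n) (d := d) (a := ((576 : ℕ) : ℝ) + 1) (b := ((204800 : ℕ) : ℝ) + 1)
      (by norm_num) (by norm_num) (hnd.trans hX)
      ((le_mul_of_one_le_right (by linarith) hd1).trans hX)
      ((le_mul_of_one_le_left (by linarith) hn1).trans hX)
      (hTle.trans (by gcongr; exact log_div_pow_le hn hd hε hε' hδ le_rfl))
      (hmle.trans (by gcongr; exact log_div_pow_le hn hd hε hε' hδ (by norm_num)))
      (length_sampled_le (choices T (coordProb c') ω.1))
    refine le_trans (by exact_mod_cast hstep) (this.trans (le_of_eq ?_))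
    push_cast
    ring
  · intro q
    set q' : Fin d → ℝ := fun b => q b with hq'
    have hn0 : 0 < n := by omega
    have : Nonempty (Fin n) := ⟨⟨0, hn0⟩⟩
    obtain ⟨j, hj⟩ := Finite.exists_min fun i => ∑ b, |c' i b - q' b|
    have hL : 0 < Real.log (n / δ) := by linarith [half_lt_log_div hn hδ hδ']
    have hT0 : 0 < T := Nat.ceil_pos.2 (by positivity)
    have hm0 : 0 < m := Nat.ceil_pos.2 (by positivity)
    have hbad := (measure_not_good c' q' j hε hε' hδ hδ' hT0 hm0).trans
      (failure_le hn hε hε' hδ hδ' (by exact_mod_cast Nat.le_ceil _) (by exact_mod_cast Nat.le_ceil _))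
    rw [measureReal_def] at hbad
    refine le_trans (measure_mono ?_) ((ENNReal.le_ofReal_iff_toReal_le (measure_ne_top _ _)
      hδ.le).2 hbad)
    -- The failure event lies in the complement of `Good`; on `Good` all three claims hold
    -- deterministically.
    intro ω hω hgood
    refine hω ?_
    have hbuild := (execute_eq 576 204800 c ε δ ω hT hm).1
    rw [hbuild]
    have hN : ((sampled (choices T (coordProb c') ω.1)).length : ℝ) ≤
        3 * n * ((((576 : ℕ) : ℝ) + 1) * (Real.log (n / δ) / (ε ^ 3 * δ ^ 2))) := by
      refine hgood.length.trans ?_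
      rw [mul_right_comm]
      gcongr
    refine ⟨?_, ?_, ?_⟩
    · refine hN.trans ?_
      rw [mul_div_assoc (n : ℝ)]
      push_cast
      have : 0 ≤ (n : ℝ) * (Real.log (n / δ) / (ε ^ 3 * δ ^ 2)) := by positivity
      linarith
    · obtain ⟨i, hi, hmin⟩ := exists_argmin_finRange hn0
        (estimate c' (coordProb c') q' (sampled (choices T (coordProb c') ω.1)) m ω.2)
      refine ⟨i, (query_memoryOf _ _ _ _ _ _).trans hi, ?_⟩
      have happ := hgood.approx c' q' j hε hε' hδ hδ' hT0 (hmin j)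
      rw [IsApproxNearest, dist_eq_sum_abs]
      refine happ.trans ?_
      gcongr
      refine le_ciInf fun i => ?_
      rw [dist_eq_sum_abs]
      exact hj i
    · rw [words_memoryOf]
      refine (words_le (d := d) (by norm_num) (by norm_num) hQ hP hd hN hmle).trans (le_of_eq ?_)
      push_cast
      field_simp
      ring
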